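/- Let $W$ be a finite Coxeter group with simple generators $s_1,\dots,s_n$ and length function $\ell$, let $V=\mathbb R^n$ be its geometric (reflection) representation, and let $d_1,\dots,d_n$ be the degrees of $W$, that is, the degrees of $n$ algebraically independent homogeneous polynomials on $V$ that generate the algebra of $W$-invariant polynomials. For $q>0$ let $\pi$ be the probability distribution $$\pi(w)=\frac{q^{\ell(w)}}{P_W(q)},\qquad P_W(q)=\sum_{w\in W}q^{\ell(w)},$$ on $W$, and let $Z(w)=\ell(w)$. Then $Z$ is a sum $Z=Z_1+\dots+Z_n$ of random variables $Z_i\colon W\to\{0,1,2,\dots\}$ that are independent under $\pi$ and have moment generating functions $$E_\pi\big(e^{tZ_i}\big)=\frac{1+e^tq+\dots+(e^tq)^{d_i-1}}{1+q+\dots+q^{d_i-1}}\qquad(t\in\mathbb R),$$ which equals $\frac{1-(e^tq)^{d_i}}{1-e^tq}\cdot\frac{1-q}{1-q^{d_i}}$ when $q\ne1$ and $e^tq\neq 1$. If moreover $q\neq1$, then $$E_\pi(Z)=\frac{nq}{1-q}-\sum_{i=1}^n\frac{d_iq^{d_i}}{1-q^{d_i}}\qquad\text{and}\qquad \mathrm{Var}_\pi(Z)=\frac{nq}{(1-q)^2}-\sum_{i=1}^n\frac{d_i^2q^{d_i}}{(1-q^{d_i})^2}.$$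 -/

import Mathlib

open MeasureTheory ProbabilityTheory

noncomputable section

namespace CoxeterMatrix

variable {B : Type*} [Fintype B] [DecidableEq B] (M : CoxeterMatrix B)

/-- The simple root `α_i`: the `i`-th standard basis vector of `V = B → ℝ`. -/
def simpleRoot (i : B) : B → ℝ := Pi.single i 1

/-- The functional `v ↦ 2 ⟨α_i, v⟩`, for the symmetric bilinear form with
`⟨α_i, α_j⟩ = -cos (π / m(i, j))`. (Mathlib writes `M i j = 0` for `m(i, j) = ∞`, and then
`-cos (π / 0) = -1`, which is the usual convention.) -/
def simpleCoroot (i : B) : Module.Dual ℝ (B → ℝ) :=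
  ∑ j, (2 * -Real.cos (Real.pi / (M i j : ℝ))) • LinearMap.proj j

theorem simpleCoroot_simpleRoot (i j : B) :
    M.simpleCoroot i (simpleRoot j) = 2 * -Real.cos (Real.pi / (M i j : ℝ)) := by
  simp [simpleCoroot, simpleRoot, Pi.single_apply]

theorem simpleCoroot_simpleRoot_self (i : B) : M.simpleCoroot i (simpleRoot i) = 2 := by
  simp [simpleCoroot_simpleRoot]

/-- The simple reflection `v ↦ v - 2 ⟨α_i, v⟩ α_i` of `V`. -/
def simpleReflection (i : B) : (B → ℝ) ≃ₗ[ℝ] (B → ℝ) :=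
  Module.reflection (M.simpleCoroot_simpleRoot_self i)

theorem isLiftable_simpleReflection : M.IsLiftable M.simpleReflection := by
  intro i j
  by_cases hij : i = j
  · subst hij
    rw [M.diagonal, pow_one]
    ext1 v
    exact Module.involutive_reflection (M.simpleCoroot_simpleRoot_self i) v
  have hne1 : M i j ≠ 1 := M.off_diagonal i j hij
  obtain ⟨m, hm⟩ : ∃ m, m = M i j := ⟨_, rfl⟩
  have hg : M.simpleCoroot i (simpleRoot j) = 2 * -Real.cos (Real.pi / m) := by
    rw [simpleCoroot_simpleRoot, hm]
  have hf : M.simpleCoroot j (simpleRoot i) = 2 * -Real.cos (Real.pi / m) := by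
    rw [simpleCoroot_simpleRoot, hm, M.symmetric]
  rw [← hm] at hne1 ⊢
  ext1 z
  rw [simpleReflection, simpleReflection,
    Module.reflection_mul_reflection_pow_apply _ _ m z
      (2 * Real.cos (2 * (Real.pi / m))) (by rw [hf, hg, Real.cos_two_mul]; ring)]
  have key := fun k : ℤ => Polynomial.Chebyshev.S_two_mul_real_cos (2 * (Real.pi / m)) k
  rcases Nat.lt_or_ge m 3 with h3 | h3
  · interval_cases m
    · norm_num [Polynomial.Chebyshev.S_neg_two]
    · exact absurd rfl hne1
    · have h2 : 2 * (Real.pi / 2) = Real.pi := by ring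
      simp only [Nat.cast_ofNat, h2, Real.cos_pi, hf, hg]
      norm_num [Polynomial.Chebyshev.S_neg_one]
      module
  have hsin : Real.sin (2 * (Real.pi / m)) ≠ 0 := by
    refine (Real.sin_pos_of_pos_of_lt_pi (by positivity) ?_).ne'
    have : (3 : ℝ) ≤ m := by exact_mod_cast h3
    rw [mul_div_assoc', div_lt_iff₀ (by linarith)]
    nlinarith [Real.pi_pos]
  have hm0 : (m : ℝ) ≠ 0 := by positivity
  rcases Nat.even_or_odd' m with ⟨k, hk | hk⟩
  · have e1 : ((m : ℤ) - 2) / 2 = k - 1 := by omega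
    have e2 : ((m : ℤ) - 1) / 2 = k - 1 := by omega
    have h0 : (Polynomial.Chebyshev.S ℝ ((k : ℤ) - 1)).eval
        (2 * Real.cos (2 * (Real.pi / m))) = 0 := by
      have h := key (k - 1)
      have e : (((k : ℤ) - 1 : ℤ) + 1 : ℝ) * (2 * (Real.pi / m)) = Real.pi := by
        push_cast
        have : (m : ℝ) = 2 * k := by exact_mod_cast hk
        field_simp
        rw [this]
        ring
      rw [e, Real.sin_pi] at h
      exact (mul_eq_zero.mp h).resolve_right hsin
    rw [e1, e2, h0]
    simp
  · have e1 : ((m : ℤ) - 2) / 2 = k - 1 := by omega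
    have e2 : ((m : ℤ) - 1) / 2 = k := by omega
    have e3 : ((m : ℤ) - 3) / 2 = k - 1 := by omega
    have e4 : (m : ℤ) / 2 = k := by omega
    have h0 : (Polynomial.Chebyshev.S ℝ (k : ℤ)).eval (2 * Real.cos (2 * (Real.pi / m))) +
        (Polynomial.Chebyshev.S ℝ ((k : ℤ) - 1)).eval (2 * Real.cos (2 * (Real.pi / m))) = 0 := by
      have h := key (k - 1)
      have h' := key k
      have hm' : (m : ℝ) = 2 * k + 1 := by exact_mod_cast hk
      have e : (((k : ℤ) - 1 : ℤ) + 1 : ℝ) * (2 * (Real.pi / m)) = Real.pi - Real.pi / m := by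
        push_cast
        field_simp
        rw [hm']
        ring
      have e' : (((k : ℤ) : ℝ) + 1) * (2 * (Real.pi / m)) = Real.pi / m + Real.pi := by
        push_cast
        field_simp
        rw [hm']
        ring
      rw [e, Real.sin_pi_sub] at h
      rw [e', Real.sin_add_pi] at h'
      refine (mul_eq_zero.mp (?_ : _ * Real.sin (2 * (Real.pi / m)) = 0)).resolve_right hsin
      rw [add_mul, h, h']
      ring
    rw [e1, e2, e3, e4, h0]
    simp

end CoxeterMatrix

namespace CoxeterSystem

variable {B : Type*} [Fintype B] [DecidableEq B] {M : CoxeterMatrix B}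
  {W : Type*} [Group W] (cs : CoxeterSystem M W)

/-- The geometric (reflection) representation of a Coxeter group on `V = B → ℝ`: the generator
`s_i` acts as the simple reflection `v ↦ v - 2 ⟨α_i, v⟩ α_i`. -/
def geometricRep : W →* ((B → ℝ) ≃ₗ[ℝ] (B → ℝ)) :=
  cs.lift ⟨M.simpleReflection, M.isLiftable_simpleReflection⟩

/-- The algebra of polynomial functions on `V` that are invariant under `W`. -/
def invariants : Subalgebra ℝ (MvPolynomial B ℝ) where
  carrier := {f | ∀ (w : W) (v : B → ℝ),
    MvPolynomial.eval (cs.geometricRep w v) f = MvPolynomial.eval v f}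
  mul_mem' hf hg w v := by rw [map_mul, map_mul, hf w v, hg w v]
  add_mem' hf hg w v := by rw [map_add, map_add, hf w v, hg w v]
  algebraMap_mem' r w v := by simp [MvPolynomial.algebraMap_eq]

/-- `d_1, …, d_n` (where `n` is the number of simple generators) are the degrees of `W`: the degrees
of a system of basic invariants, that is, of `n` algebraically independent homogeneous polynomials
that generate the algebra of invariants of `W`. -/
def IsDegrees (d : Fin (Fintype.card B) → ℕ) : Prop :=
  ∃ f : Fin (Fintype.card B) → MvPolynomial B ℝ,
    (∀ i, (f i).IsHomogeneous (d i)) ∧ AlgebraicIndependent ℝ f ∧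
      Algebra.adjoin ℝ (Set.range f) = cs.invariants

end CoxeterSystem

namespace CoxeterSystem

variable {B : Type*} {M : CoxeterMatrix B} {W : Type*} [Group W] [Fintype W]
  (cs : CoxeterSystem M W)

/-- The Poincaré polynomial `P_W(q) = ∑_w q ^ ℓ(w)`. -/
def poincare (q : ℝ) : ℝ := ∑ w : W, q ^ cs.length w

/-- The measure on `W` that gives `w` the mass `q ^ ℓ(w) / P_W(q)`. -/
def mallows [MeasurableSpace W] (q : ℝ) : Measure W :=
  ∑ w : W, ENNReal.ofReal (q ^ cs.length w / cs.poincare q) • Measure.dirac w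

end CoxeterSystem

end

set_option linter.unusedSectionVars false

/-! ### Simple reflections and the canonical bilinear form -/

noncomputable section

namespace CoxeterMatrix

variable {B : Type*} [Fintype B] [DecidableEq B] (M : CoxeterMatrix B)

/-! The heart is the factorization P_W(q) = ∏ (1 + q + ⋯ + q^(d_i - 1)). It follows by comparing
Hilbert series once the polynomials are known to be free over the invariants, with a homogeneous
basis of degrees ℓ(w), w ∈ W (`exists_basis_invariants`): counting monomials by degree, and counting
products of basic invariants with this basis, gives (1 - q)^(-n) = P_W(q) ∏ (1 - q^(d_i))^(-1).

Freeness comes from the divided differences ∂_i f = (f - s_i f)/α_i^∨. Their composite along a word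
depends only on the product of the word and vanishes if the word is not reduced
(`demazureWord_wellDefined`). No braid relation is checked for this: commuting a composite past a
linear form (`demazureWord_linearPoly_mul`) yields a sum over the inversions of the group element,
and these do not depend on the reduced word. Positivity of roots makes ∂_{w₀} nonzero on a power of
the height; divided differences of that power give polynomials P_w whose matrix ∂_u P_w is block
unitriangular. Solving the linear system expands every polynomial in the P_w, and the coefficients
turn out to be invariant.

Comparing coefficients in the factorization yields a bijection of W with ∏ {0, …, d_i - 1} that
turns ℓ into the sum of the coordinates (`IsDegrees.exists_equiv`). The coordinates are the Z_i: the
mass q^ℓ(w)/P_W(q) factors, so they are independent truncated geometric variables, and the mean and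
variance add up. -/

theorem simpleReflection_apply (i : B) (v : B → ℝ) :
    M.simpleReflection i v = v - M.simpleCoroot i v • simpleRoot i := rfl

theorem simpleReflection_simpleRoot (i j : B) :
    M.simpleReflection i (simpleRoot j) =
      simpleRoot j + (2 * Real.cos (Real.pi / (M i j : ℝ))) • simpleRoot i := by
  rw [simpleReflection_apply, simpleCoroot_simpleRoot, mul_neg, neg_smul, sub_neg_eq_add]

theorem simpleReflection_simpleRoot_self (i : B) :
    M.simpleReflection i (simpleRoot i) = -simpleRoot i := by
  rw [simpleReflection_apply, simpleCoroot_simpleRoot_self]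
  module

theorem simpleReflection_simpleReflection (i : B) (v : B → ℝ) :
    M.simpleReflection i (M.simpleReflection i v) = v :=
  Module.involutive_reflection (M.simpleCoroot_simpleRoot_self i) v

theorem simpleRoot_nonneg (i : B) : 0 ≤ (simpleRoot i : B → ℝ) :=
  Pi.single_nonneg.2 zero_le_one

theorem simpleRoot_ne_zero (i : B) : (simpleRoot i : B → ℝ) ≠ 0 := by
  simp [simpleRoot]

theorem eq_sum_simpleRoot (v : B → ℝ) : v = ∑ i, v i • simpleRoot i := by
  ext j
  simp [simpleRoot, Pi.single_apply]

/-- The canonical bilinear form, paired with a vector through the simple coroots. -/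
def canonicalForm (x y : B → ℝ) : ℝ := ∑ i, x i * M.simpleCoroot i y

theorem simpleCoroot_apply (i : B) (v : B → ℝ) :
    M.simpleCoroot i v = ∑ j, 2 * -Real.cos (Real.pi / (M i j : ℝ)) * v j := by
  simp [simpleCoroot]

theorem canonicalForm_comm (x y : B → ℝ) : M.canonicalForm x y = M.canonicalForm y x := by
  simp only [canonicalForm, simpleCoroot_apply, Finset.mul_sum]
  rw [Finset.sum_comm]
  refine Finset.sum_congr rfl fun i _ => Finset.sum_congr rfl fun j _ => ?_
  rw [M.symmetric]
  ring

theorem canonicalForm_sub_smul_left (x z y : B → ℝ) (c : ℝ) :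
    M.canonicalForm (x - c • z) y = M.canonicalForm x y - c * M.canonicalForm z y := by
  simp only [canonicalForm, Pi.sub_apply, Pi.smul_apply, smul_eq_mul, Finset.mul_sum,
    ← Finset.sum_sub_distrib]
  exact Finset.sum_congr rfl fun i _ => by ring

theorem canonicalForm_sub_smul_right (x z y : B → ℝ) (c : ℝ) :
    M.canonicalForm y (x - c • z) = M.canonicalForm y x - c * M.canonicalForm y z := by
  rw [canonicalForm_comm, canonicalForm_sub_smul_left, M.canonicalForm_comm x,
    M.canonicalForm_comm z]

theorem canonicalForm_simpleRoot_left (i : B) (y : B → ℝ) :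
    M.canonicalForm (simpleRoot i) y = M.simpleCoroot i y := by
  simp [canonicalForm, simpleRoot, Pi.single_apply]

theorem canonicalForm_simpleReflection (i : B) (x y : B → ℝ) :
    M.canonicalForm (M.simpleReflection i x) (M.simpleReflection i y) = M.canonicalForm x y := by
  simp only [simpleReflection_apply, canonicalForm_sub_smul_left, canonicalForm_sub_smul_right,
    M.canonicalForm_comm x (simpleRoot i), canonicalForm_simpleRoot_left,
    simpleCoroot_simpleRoot_self]
  ring

end CoxeterMatrix

/-! ### Descents and the sign of w α_s -/

open CoxeterMatrix

/-- The values `sin (n θ) / sin θ`, through their recursion in `c = 2 cos θ`. -/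
def chebyshevSin (c : ℝ) : ℕ → ℝ
  | 0 => 0
  | 1 => 1
  | n + 2 => c * chebyshevSin c (n + 1) - chebyshevSin c n

theorem sin_mul_chebyshevSin (θ : ℝ) (n : ℕ) :
    Real.sin θ * chebyshevSin (2 * Real.cos θ) n = Real.sin (n * θ) := by
  induction n using Nat.twoStepInduction with
  | zero => simp [chebyshevSin]
  | one => simp [chebyshevSin]
  | more n h0 h1 =>
    rw [chebyshevSin, mul_sub, mul_left_comm, h1, h0]
    have e0 : (n : ℝ) * θ = ((n + 1 : ℕ) : ℝ) * θ - θ := by push_cast; ring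
    have e2 : ((n + 2 : ℕ) : ℝ) * θ = ((n + 1 : ℕ) : ℝ) * θ + θ := by push_cast; ring
    rw [e0, e2, Real.sin_sub, Real.sin_add]
    ring

theorem chebyshevSin_two (n : ℕ) : chebyshevSin 2 n = n := by
  induction n using Nat.twoStepInduction with
  | zero => simp [chebyshevSin]
  | one => simp [chebyshevSin]
  | more n h0 h1 =>
    rw [chebyshevSin, h0, h1]
    push_cast
    ring

/-- Up to the positive factor sin (π/m) this is sin (nπ/m), with nπ/m ≤ π. For m = ∞, coded as 0,
the angle π/0 is 0 and the value is n. -/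
theorem chebyshevSin_nonneg {m n : ℕ} (hm : m ≠ 1) (h : m = 0 ∨ n ≤ m) :
    0 ≤ chebyshevSin (2 * Real.cos (Real.pi / (m : ℝ))) n := by
  rcases Nat.eq_zero_or_pos m with rfl | hm0
  · simp [chebyshevSin_two]
  have h2 : (2 : ℝ) ≤ m := by exact_mod_cast (by omega : 2 ≤ m)
  have hs : 0 < Real.sin (Real.pi / (m : ℝ)) := by
    refine Real.sin_pos_of_pos_of_lt_pi (by positivity) ?_
    rw [div_lt_iff₀ (by linarith)]
    nlinarith [Real.pi_pos]
  refine nonneg_of_mul_nonneg_right ?_ hs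
  rw [sin_mul_chebyshevSin]
  have hn : (n : ℝ) ≤ m := by exact_mod_cast h.resolve_left hm0.ne'
  refine Real.sin_nonneg_of_nonneg_of_le_pi (by positivity) ?_
  rw [mul_div_assoc', div_le_iff₀ (by linarith), mul_comm]
  exact mul_le_mul_of_nonneg_left hn Real.pi_pos.le

namespace CoxeterSystem

variable {B : Type*} [Fintype B] [DecidableEq B] {M : CoxeterMatrix B}
  {W : Type*} [Group W] (cs : CoxeterSystem M W)

@[simp]
theorem geometricRep_simple (i : B) : cs.geometricRep (cs.simple i) = M.simpleReflection i :=
  cs.lift_apply_simple M.isLiftable_simpleReflection i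

theorem geometricRep_mul_apply (u w : W) (v : B → ℝ) :
    cs.geometricRep (u * w) v = cs.geometricRep u (cs.geometricRep w v) := by
  rw [map_mul]
  rfl

theorem geometricRep_one_apply (v : B → ℝ) : cs.geometricRep 1 v = v := by
  rw [map_one]
  rfl

theorem geometricRep_inv_apply_apply (w : W) (v : B → ℝ) :
    cs.geometricRep w⁻¹ (cs.geometricRep w v) = v := by
  rw [← geometricRep_mul_apply, inv_mul_cancel, geometricRep_one_apply]

theorem geometricRep_apply_inv_apply (w : W) (v : B → ℝ) :
    cs.geometricRep w (cs.geometricRep w⁻¹ v) = v := by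
  rw [← geometricRep_mul_apply, mul_inv_cancel, geometricRep_one_apply]

theorem geometricRep_mul_simple_simpleRoot (w : W) (i : B) :
    cs.geometricRep (w * cs.simple i) (simpleRoot i) = -cs.geometricRep w (simpleRoot i) := by
  rw [geometricRep_mul_apply, geometricRep_simple, simpleReflection_simpleRoot_self, map_neg]

/-- The dihedral computation: each further letter reflects inside the plane of α_s and α_t, and the
coefficients obey the recursion of `chebyshevSin`. The parity of j tells which letter was applied
last. -/
theorem geometricRep_alternatingWord (s t : B) (j : ℕ) :
    cs.geometricRep (cs.wordProd (alternatingWord s t j)) (simpleRoot s) =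
      if Even j then
        chebyshevSin (2 * Real.cos (Real.pi / (M s t : ℝ))) (j + 1) • simpleRoot s +
          chebyshevSin (2 * Real.cos (Real.pi / (M s t : ℝ))) j • simpleRoot t
      else
        chebyshevSin (2 * Real.cos (Real.pi / (M s t : ℝ))) (j + 1) • simpleRoot t +
          chebyshevSin (2 * Real.cos (Real.pi / (M s t : ℝ))) j • simpleRoot s := by
  induction j with
  | zero => simp [alternatingWord, chebyshevSin]
  | succ j ih =>
    rw [alternatingWord_succ', wordProd_cons, geometricRep_mul_apply, ih]
    by_cases hj : Even j
    · rw [if_pos hj, if_pos hj, if_neg (by simpa [Nat.even_add_one] using hj), chebyshevSin,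
        geometricRep_simple, map_add, map_smul, map_smul, simpleReflection_simpleRoot_self,
        simpleReflection_simpleRoot, M.symmetric t s]
      module
    · rw [if_neg hj, if_neg hj, if_pos (by simpa [Nat.even_add_one] using hj), chebyshevSin,
        geometricRep_simple, map_add, map_smul, map_smul, simpleReflection_simpleRoot_self,
        simpleReflection_simpleRoot]
      module

theorem length_mul_wordProd_le (w : W) (ω : List B) :
    cs.length (w * cs.wordProd ω) ≤ cs.length w + ω.length :=
  (cs.length_mul_le _ _).trans (Nat.add_le_add_left (cs.length_wordProd_le ω) _)

/-- If `w s > w` and `t` is a right descent of `w`, then `w = v a` with `a` a non-empty alternating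
word in `s, t` that ends in `t`, `v s > v` and `v t > v`. -/
theorem exists_alternating_factorization {w : W} {s t : B}
    (hs : ¬cs.IsRightDescent w s) (ht : cs.IsRightDescent w t) :
    ∃ (v : W) (j : ℕ), w = v * cs.wordProd (alternatingWord s t j) ∧ cs.length v < cs.length w ∧
      (M s t = 0 ∨ j < M s t) ∧ ¬cs.IsRightDescent v s ∧ ¬cs.IsRightDescent v t := by
  classical
  -- The factor a is the longest alternating suffix, of length at most m(s,t), that splits off with
  -- lengths adding.
  let Q : ℕ → Prop := fun j => (M s t = 0 ∨ j ≤ M s t) ∧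
    ∃ v : W, w = v * cs.wordProd (alternatingWord s t j) ∧ cs.length w = cs.length v + j
  have hst : s ≠ t := by
    rintro rfl
    exact hs ht
  have hQ1 : Q 1 := by
    refine ⟨?_, w * cs.simple t, ?_, ?_⟩
    · omega
    · simp [alternatingWord]
    · exact (cs.isRightDescent_iff.1 ht).symm
  have hbound : ∀ j, Q j → j ≤ cs.length w := by
    rintro j ⟨-, v, -, h⟩
    omega
  obtain ⟨j, hj⟩ : ∃ j, j = Nat.findGreatest Q (cs.length w) := ⟨_, rfl⟩
  have hQj : Q j := hj ▸ Nat.findGreatest_spec (hbound 1 hQ1) hQ1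
  have h1j : 1 ≤ j := hj ▸ Nat.le_findGreatest (hbound 1 hQ1) hQ1
  have hmax : ¬Q (j + 1) := fun h => by
    have := Nat.le_findGreatest (hbound _ h) h
    omega
  obtain ⟨hm, v, hw, hl⟩ := hQj
  have hlt : M s t = 0 ∨ j < M s t := by
    rcases hm with hm | hm
    · exact Or.inl hm
    -- At full length m(s,t) the braid relation would rewrite the suffix to end in s, making s a
    -- descent of w.
    refine Or.inr (lt_of_le_of_ne hm ?_)
    rintro rfl
    refine hs ?_
    have hb : cs.wordProd (alternatingWord s t (M s t)) =
        cs.wordProd (alternatingWord t s (M s t)) := by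
      have := cs.wordProd_braidWord_eq s t
      rwa [braidWord, braidWord, M.symmetric t s] at this
    obtain ⟨k, hk⟩ : ∃ k, M s t = k + 1 := ⟨M s t - 1, by omega⟩
    have e : w * cs.simple s = v * cs.wordProd (alternatingWord s t k) := by
      rw [hw, hb, hk, alternatingWord_succ, wordProd_concat, ← mul_assoc, mul_assoc _ _
        (cs.simple s), simple_mul_simple_self, mul_one]
    have := cs.length_mul_wordProd_le v (alternatingWord s t k)
    rw [← e, length_alternatingWord] at this
    rw [IsRightDescent]
    omega
  refine ⟨v, j, hw, by omega, hlt, ?_⟩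
  obtain ⟨k, rfl⟩ : ∃ k, j = k + 1 := ⟨j - 1, by omega⟩
  -- If the first letter of a were a descent of v, absorbing it into v would make w too short.
  have hfirst : ¬cs.IsRightDescent v (if Even k then t else s) := by
    intro h
    rw [alternatingWord_succ', wordProd_cons, ← mul_assoc] at hw
    have := cs.length_mul_wordProd_le (v * cs.simple (if Even k then t else s))
      (alternatingWord s t k)
    rw [← hw, length_alternatingWord] at this
    rw [IsRightDescent] at h
    omega
  -- The other letter is excluded by maximality: it would extend the suffix.
  have hsecond : ¬cs.IsRightDescent v (if Even (k + 1) then t else s) := by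
    intro h
    refine hmax ⟨by omega, v * cs.simple (if Even (k + 1) then t else s), ?_, ?_⟩
    · rw [alternatingWord_succ' _ _ (k + 1), wordProd_cons, ← mul_assoc,
        cs.simple_mul_simple_cancel_right, hw]
    · have := cs.isRightDescent_iff.1 h
      omega
  by_cases hk : Even k
  · rw [if_pos hk] at hfirst
    rw [if_neg (by simpa [Nat.even_add_one] using hk)] at hsecond
    exact ⟨hsecond, hfirst⟩
  · rw [if_neg hk] at hfirst
    rw [if_pos (by simpa [Nat.even_add_one] using hk)] at hsecond
    exact ⟨hfirst, hsecond⟩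

/-- Induction on length. In the factorization w = v a the vector a α_s is a nonnegative combination
of α_s and α_t, and neither s nor t is a descent of the shorter v. -/
theorem geometricRep_simpleRoot_nonneg {w : W} {s : B} (hs : ¬cs.IsRightDescent w s) :
    0 ≤ cs.geometricRep w (simpleRoot s) := by
  induction hn : cs.length w using Nat.strong_induction_on generalizing w s with
  | _ n ih =>
    subst hn
    by_cases hw1 : w = 1
    · rw [hw1, geometricRep_one_apply]
      exact simpleRoot_nonneg s
    obtain ⟨t, ht⟩ := cs.exists_rightDescent_of_ne_one hw1
    obtain ⟨v, j, hw, hlen, hj, hvs, hvt⟩ := cs.exists_alternating_factorization hs ht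
    have hst : s ≠ t := by
      rintro rfl
      exact hs ht
    have h1 : M s t ≠ 1 := M.off_diagonal s t hst
    have hs0 := ih _ hlen hvs rfl
    have ht0 := ih _ hlen hvt rfl
    have c1 := chebyshevSin_nonneg (n := j + 1) h1 (by omega)
    have c0 := chebyshevSin_nonneg (n := j) h1 (by omega)
    rw [hw, geometricRep_mul_apply, geometricRep_alternatingWord]
    split_ifs
    · rw [map_add, map_smul, map_smul]
      exact add_nonneg (smul_nonneg c1 hs0) (smul_nonneg c0 ht0)
    · rw [map_add, map_smul, map_smul]
      exact add_nonneg (smul_nonneg c1 ht0) (smul_nonneg c0 hs0)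

theorem geometricRep_simpleRoot_nonpos {w : W} {s : B} (hs : cs.IsRightDescent w s) :
    cs.geometricRep w (simpleRoot s) ≤ 0 := by
  have h := cs.geometricRep_simpleRoot_nonneg
    (cs.isRightDescent_iff_not_isRightDescent_mul.1 hs)
  rwa [geometricRep_mul_simple_simpleRoot, Left.nonneg_neg_iff] at h

theorem geometricRep_ne_zero (w : W) {v : B → ℝ} (hv : v ≠ 0) : cs.geometricRep w v ≠ 0 :=
  (LinearEquiv.map_ne_zero_iff _).2 hv

theorem isRightDescent_iff_nonpos {w : W} {s : B} :
    cs.IsRightDescent w s ↔ cs.geometricRep w (simpleRoot s) ≤ 0 := by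
  refine ⟨cs.geometricRep_simpleRoot_nonpos, fun h => ?_⟩
  by_contra hs
  exact cs.geometricRep_ne_zero w (simpleRoot_ne_zero s)
    (le_antisymm h (cs.geometricRep_simpleRoot_nonneg hs))

theorem geometricRep_injective : Function.Injective cs.geometricRep := by
  rw [injective_iff_map_eq_one]
  intro w hw
  by_contra h1
  obtain ⟨t, ht⟩ := cs.exists_rightDescent_of_ne_one h1
  have h := cs.geometricRep_simpleRoot_nonpos ht
  rw [hw] at h
  exact simpleRoot_ne_zero t (le_antisymm h (simpleRoot_nonneg t))

/-! ### Roots, reflections and inversions of reduced words -/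

theorem canonicalForm_geometricRep (w : W) (x y : B → ℝ) :
    M.canonicalForm (cs.geometricRep w x) (cs.geometricRep w y) = M.canonicalForm x y := by
  induction w using cs.simple_induction_left with
  | one => simp
  | mul_simple_left w i ih =>
    rw [geometricRep_mul_apply, geometricRep_mul_apply, geometricRep_simple,
      canonicalForm_simpleReflection, ih]

theorem geometricRep_conj_simple_apply (w : W) (i : B) (v : B → ℝ) :
    cs.geometricRep (w * cs.simple i * w⁻¹) v =
      v - M.canonicalForm (cs.geometricRep w (simpleRoot i)) v •
        cs.geometricRep w (simpleRoot i) := by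
  rw [geometricRep_mul_apply, geometricRep_mul_apply, geometricRep_simple, simpleReflection_apply,
    map_sub, map_smul, geometricRep_apply_inv_apply, ← canonicalForm_simpleRoot_left,
    ← cs.canonicalForm_geometricRep w, geometricRep_apply_inv_apply]

/-- The roots: the images of the simple roots under the group. -/
def IsRoot (β : B → ℝ) : Prop := ∃ (w : W) (i : B), cs.geometricRep w (simpleRoot i) = β

theorem isRoot_simpleRoot (i : B) : cs.IsRoot (simpleRoot i) :=
  ⟨1, i, cs.geometricRep_one_apply _⟩

variable {cs} in
theorem IsRoot.map {β : B → ℝ} (h : cs.IsRoot β) (w : W) : cs.IsRoot (cs.geometricRep w β) := by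
  obtain ⟨u, i, rfl⟩ := h
  exact ⟨w * u, i, cs.geometricRep_mul_apply _ _ _⟩

variable {cs} in
theorem IsRoot.ne_zero {β : B → ℝ} (h : cs.IsRoot β) : β ≠ 0 := by
  obtain ⟨u, i, rfl⟩ := h
  exact cs.geometricRep_ne_zero u (simpleRoot_ne_zero i)

variable {cs} in
theorem IsRoot.nonneg_or_nonpos {β : B → ℝ} (h : cs.IsRoot β) : 0 ≤ β ∨ β ≤ 0 := by
  obtain ⟨u, i, rfl⟩ := h
  by_cases hd : cs.IsRightDescent u i
  · exact Or.inr (cs.geometricRep_simpleRoot_nonpos hd)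
  · exact Or.inl (cs.geometricRep_simpleRoot_nonneg hd)

variable {cs} in
theorem IsRoot.canonicalForm_self {β : B → ℝ} (h : cs.IsRoot β) : M.canonicalForm β β = 2 := by
  obtain ⟨u, i, rfl⟩ := h
  rw [canonicalForm_geometricRep, canonicalForm_simpleRoot_left, simpleCoroot_simpleRoot_self]

variable {cs} in
/-- A simple reflection permutes the positive roots other than its own simple root. -/
theorem IsRoot.eq_simpleRoot {β : B → ℝ} (h : cs.IsRoot β) (hβ : 0 ≤ β) {i : B}
    (hi : M.simpleReflection i β ≤ 0) : β = simpleRoot i := by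
  -- A simple reflection changes only the i-th coordinate, so the others are both nonnegative and
  -- nonpositive. The norm 2 of a root then fixes the remaining one.
  have hj : ∀ j, j ≠ i → β j = 0 := by
    intro j hji
    refine le_antisymm ?_ (hβ j)
    have := hi j
    simpa [simpleReflection_apply, simpleRoot, Pi.single_apply, hji] using this
  obtain ⟨c, hc⟩ : ∃ c, c = β i := ⟨_, rfl⟩
  have hβi : β = c • simpleRoot i := by
    ext j
    by_cases hji : j = i
    · subst hji
      simp [simpleRoot, hc]
    · simp [simpleRoot, hji, hj j hji]
  have hc0 : 0 ≤ c := hc ▸ hβ i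
  have hsq := h.canonicalForm_self
  rw [hβi, canonicalForm, Finset.sum_eq_single i
    (fun j _ hji => by simp [simpleRoot, hji]) (by simp), map_smul,
    simpleCoroot_simpleRoot_self] at hsq
  simp only [simpleRoot, Pi.smul_apply, Pi.single_eq_same, smul_eq_mul] at hsq
  have : c = 1 := by nlinarith
  rw [hβi, this, one_smul]

/-- The reflection of a root, as an element of the group. -/
def rootReflection (β : B → ℝ) : W :=
  open Classical in
  if h : cs.IsRoot β then h.choose * cs.simple h.choose_spec.choose * h.choose⁻¹ else 1

/-- The choice in the definition is harmless: the operator of w s_i w⁻¹ is determined by the root w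
α_i, and the representation is faithful. -/
theorem rootReflection_geometricRep (w : W) (i : B) :
    cs.rootReflection (cs.geometricRep w (simpleRoot i)) = w * cs.simple i * w⁻¹ := by
  have h : cs.IsRoot (cs.geometricRep w (simpleRoot i)) := ⟨w, i, rfl⟩
  rw [rootReflection, dif_pos h]
  apply cs.geometricRep_injective
  ext1 v
  rw [geometricRep_conj_simple_apply, geometricRep_conj_simple_apply, h.choose_spec.choose_spec]

theorem isReduced_cons {i : B} {ω : List B} (h : cs.IsReduced (i :: ω)) :
    cs.IsReduced ω ∧ 0 ≤ cs.geometricRep (cs.wordProd ω)⁻¹ (simpleRoot i) := by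
  have hω : cs.IsReduced ω := by simpa using h.drop 1
  refine ⟨hω, cs.geometricRep_simpleRoot_nonneg ?_⟩
  rw [isRightDescent_inv_iff, IsLeftDescent, ← wordProd_cons, h.eq, hω.eq]
  simp

/-- The words obtained from `ω` by erasing one letter, each with the root that goes with it. -/
def erasures : List B → List ((B → ℝ) × List B)
  | [] => []
  | i :: ω => (cs.geometricRep (cs.wordProd ω)⁻¹ (simpleRoot i), ω) ::
      (erasures ω).map fun p => (p.1, i :: p.2)

theorem length_of_mem_erasures {ω : List B} {p : (B → ℝ) × List B} (hp : p ∈ cs.erasures ω) :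
    p.2.length + 1 = ω.length := by
  induction ω generalizing p with
  | nil => simp [erasures] at hp
  | cons i ω ih =>
    rw [erasures, List.mem_cons, List.mem_map] at hp
    rcases hp with rfl | ⟨p, hp, rfl⟩
    · rfl
    · simp [← ih hp]

/-- If x s_i y is the product, erasing s_i gives x y = (x s_i y)(y⁻¹ s_i y), and y⁻¹ α_i is the
recorded root. -/
theorem wordProd_of_mem_erasures {ω : List B} {p : (B → ℝ) × List B} (hp : p ∈ cs.erasures ω) :
    cs.wordProd p.2 = cs.wordProd ω * cs.rootReflection p.1 := by
  induction ω generalizing p with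
  | nil => simp [erasures] at hp
  | cons i ω ih =>
    rw [erasures, List.mem_cons, List.mem_map] at hp
    rcases hp with rfl | ⟨p, hp, rfl⟩
    · rw [rootReflection_geometricRep, wordProd_cons]
      simp [mul_assoc]
    · rw [wordProd_cons, wordProd_cons, ih hp, mul_assoc]

/-- These are the inversions of the product, hence independent of the reduced word. Prepending i
adds only the root that ω sends to α_i, since s_i changes the sign of no other positive root. -/
theorem mem_map_fst_erasures {ω : List B} (hω : cs.IsReduced ω) (β : B → ℝ) :
    β ∈ (cs.erasures ω).map Prod.fst ↔
      cs.IsRoot β ∧ 0 ≤ β ∧ cs.geometricRep (cs.wordProd ω) β ≤ 0 := by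
  induction ω with
  | nil =>
    simp only [erasures, List.map_nil, List.not_mem_nil, wordProd_nil, geometricRep_one_apply,
      false_iff]
    rintro ⟨h, h0, h1⟩
    exact h.ne_zero (le_antisymm h1 h0)
  | cons i ω ih =>
    obtain ⟨hω', hpos⟩ := cs.isReduced_cons hω
    have e : ((cs.erasures ω).map fun p => (p.1, i :: p.2)).map Prod.fst =
        (cs.erasures ω).map Prod.fst := by
      simp
    rw [erasures, List.map_cons, e, List.mem_cons, ih hω', wordProd_cons, geometricRep_mul_apply,
      geometricRep_simple]
    constructor
    · rintro (rfl | ⟨h, h0, h1⟩)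
      · refine ⟨(cs.isRoot_simpleRoot i).map _, hpos, ?_⟩
        rw [geometricRep_apply_inv_apply, simpleReflection_simpleRoot_self]
        exact neg_nonpos.2 (simpleRoot_nonneg i)
      · refine ⟨h, h0, ?_⟩
        rcases ((h.map (cs.wordProd ω)).map (cs.simple i)).nonneg_or_nonpos with h2 | h2
        -- A sign change back under s_i would force ω β = -α_i, making β negative.
        · exfalso
          rw [geometricRep_simple] at h2
          have h3 : cs.IsRoot (M.simpleReflection i (cs.geometricRep (cs.wordProd ω) β)) := by
            rw [← cs.geometricRep_simple]
            exact (h.map _).map _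
          have h4 := h3.eq_simpleRoot h2 (i := i)
            (by rwa [simpleReflection_simpleReflection])
          have h5 : cs.geometricRep (cs.wordProd ω) β = -simpleRoot i := by
            rw [← simpleReflection_simpleRoot_self, ← h4, simpleReflection_simpleReflection]
          have h6 : β = -cs.geometricRep (cs.wordProd ω)⁻¹ (simpleRoot i) := by
            rw [← map_neg, ← h5, geometricRep_inv_apply_apply]
          exact h.ne_zero (le_antisymm (h6 ▸ neg_nonpos.2 hpos) h0)
        · rwa [geometricRep_simple] at h2
    · rintro ⟨h, h0, h1⟩
      rcases (h.map (cs.wordProd ω)).nonneg_or_nonpos with h2 | h2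
      · left
        rw [← (h.map (cs.wordProd ω)).eq_simpleRoot h2 h1, geometricRep_inv_apply_apply]
      · exact Or.inr ⟨h, h0, h2⟩

theorem nodup_map_fst_erasures {ω : List B} (hω : cs.IsReduced ω) :
    ((cs.erasures ω).map Prod.fst).Nodup := by
  induction ω with
  | nil => simp [erasures]
  | cons i ω ih =>
    obtain ⟨hω', hpos⟩ := cs.isReduced_cons hω
    have e : ((cs.erasures ω).map fun p => (p.1, i :: p.2)).map Prod.fst =
        (cs.erasures ω).map Prod.fst := by
      simp
    rw [erasures, List.map_cons, e, List.nodup_cons]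
    refine ⟨fun h => ?_, ih hω'⟩
    have := ((cs.mem_map_fst_erasures hω' _).1 h).2.2
    rw [geometricRep_apply_inv_apply] at this
    exact simpleRoot_ne_zero i (le_antisymm this (simpleRoot_nonneg i))

theorem map_fst_erasures_perm {ω ω' : List B} (hω : cs.IsReduced ω) (hω' : cs.IsReduced ω')
    (h : cs.wordProd ω = cs.wordProd ω') :
    ((cs.erasures ω).map Prod.fst).Perm ((cs.erasures ω').map Prod.fst) := by
  classical
  refine (List.perm_ext_iff_of_nodup (cs.nodup_map_fst_erasures hω)
    (cs.nodup_map_fst_erasures hω')).2 fun β => ?_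
  rw [cs.mem_map_fst_erasures hω, cs.mem_map_fst_erasures hω', h]

end CoxeterSystem

end

/-! ### Polynomial functions and divided differences -/

noncomputable section

namespace MvPolynomial

theorem IsHomogeneous.eq_C {σ : Type*} {f : MvPolynomial σ ℝ} (hf : f.IsHomogeneous 0) :
    ∃ a, f = C a :=
  ⟨_, totalDegree_eq_zero_iff_eq_C.1 ((totalDegree_zero_iff_isHomogeneous σ).2 hf)⟩

theorem IsHomogeneous.mem_of_X_mul_mem {σ : Type*} {n : ℕ} {f : MvPolynomial σ ℝ}
    (hf : f.IsHomogeneous (n + 1)) (p : Submodule ℝ (MvPolynomial σ ℝ))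
    (h : ∀ j g, g.IsHomogeneous n → X j * g ∈ p) : f ∈ p := by
  classical
  rw [f.as_sum]
  refine p.sum_mem fun d hd => ?_
  have hdeg : n + 1 = d.degree := hf.degree_eq_sum_deg_support hd
  obtain ⟨j, hj⟩ : ∃ j, d j ≠ 0 := by
    by_contra! h0
    have : d = 0 := Finsupp.ext h0
    simp [this] at hdeg
  have hle : Finsupp.single j 1 ≤ d := by
    rw [Finsupp.single_le_iff]
    omega
  have e : d = Finsupp.single j 1 + (d - Finsupp.single j 1) := (add_tsub_cancel_of_le hle).symm
  rw [e, monomial_single_add, pow_one]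
  refine h j _ (isHomogeneous_monomial _ ?_)
  have := congrArg Finsupp.degree e
  rw [map_add, Finsupp.degree_single] at this
  omega

variable {B : Type*} [Fintype B] [DecidableEq B]

/-- A linear functional on `B → ℝ`, as a polynomial. -/
def linearPoly (φ : Module.Dual ℝ (B → ℝ)) : MvPolynomial B ℝ :=
  ∑ j, C (φ (CoxeterMatrix.simpleRoot j)) * X j

theorem eval_linearPoly (φ : Module.Dual ℝ (B → ℝ)) (v : B → ℝ) :
    eval v (linearPoly φ) = φ v := by
  rw [linearPoly, map_sum]
  conv_rhs => rw [CoxeterMatrix.eq_sum_simpleRoot v, map_sum]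
  exact Finset.sum_congr rfl fun j _ => by simp [mul_comm]

theorem X_eq_linearPoly (j : B) : (X j : MvPolynomial B ℝ) = linearPoly (LinearMap.proj j) :=
  funext fun v => by simp [eval_linearPoly]

theorem isHomogeneous_linearPoly (φ : Module.Dual ℝ (B → ℝ)) : (linearPoly φ).IsHomogeneous 1 :=
  IsHomogeneous.sum _ _ _ fun j _ => (isHomogeneous_X ℝ j).C_mul _

end MvPolynomial

open CoxeterMatrix MvPolynomial

namespace CoxeterSystem

variable {B : Type*} [Fintype B] [DecidableEq B] {M : CoxeterMatrix B}
  {W : Type*} [Group W] (cs : CoxeterSystem M W)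

/-- The action of the group on polynomial functions: `(w f)(v) = f(w⁻¹ v)`. -/
def polyAct (w : W) : MvPolynomial B ℝ →ₐ[ℝ] MvPolynomial B ℝ :=
  aeval fun j => linearPoly (LinearMap.proj j ∘ₗ (cs.geometricRep w⁻¹).toLinearMap)

theorem eval_polyAct (w : W) (v : B → ℝ) (f : MvPolynomial B ℝ) :
    eval v (cs.polyAct w f) = eval (cs.geometricRep w⁻¹ v) f := by
  induction f using MvPolynomial.induction_on with
  | C a => simp [polyAct]
  | add p q hp hq => rw [map_add, map_add, map_add, hp, hq]
  | mul_X p j hp =>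
    rw [map_mul, map_mul, map_mul, hp]
    simp [polyAct, eval_linearPoly]

theorem polyAct_linearPoly (w : W) (φ : Module.Dual ℝ (B → ℝ)) :
    cs.polyAct w (linearPoly φ) = linearPoly (φ ∘ₗ (cs.geometricRep w⁻¹).toLinearMap) :=
  MvPolynomial.funext fun v => by simp [eval_polyAct, eval_linearPoly]

theorem polyAct_mul_apply (u w : W) (f : MvPolynomial B ℝ) :
    cs.polyAct (u * w) f = cs.polyAct u (cs.polyAct w f) :=
  MvPolynomial.funext fun v => by
    simp only [eval_polyAct, mul_inv_rev, geometricRep_mul_apply]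

theorem polyAct_one_apply (f : MvPolynomial B ℝ) : cs.polyAct 1 f = f :=
  MvPolynomial.funext fun v => by
    rw [eval_polyAct, inv_one, geometricRep_one_apply]

theorem mem_invariants_iff {f : MvPolynomial B ℝ} :
    f ∈ cs.invariants ↔ ∀ w, cs.polyAct w f = f := by
  constructor
  · intro h w
    refine MvPolynomial.funext fun v => ?_
    rw [eval_polyAct]
    exact h w⁻¹ v
  · intro h w v
    rw [← inv_inv w, ← eval_polyAct, h]

variable (M) in
/-- The simple coroot as a polynomial: it cuts out the mirror of a simple reflection. -/
def corootPoly (i : B) : MvPolynomial B ℝ := linearPoly (M.simpleCoroot i)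

theorem corootPoly_ne_zero (i : B) : corootPoly M i ≠ 0 := by
  intro h
  have := congrArg (eval (simpleRoot i)) h
  rw [corootPoly, eval_linearPoly, simpleCoroot_simpleRoot_self] at this
  norm_num at this

/-- The map f ↦ f - s f obeys a twisted Leibniz rule, so it suffices to treat the variables; there
the difference is a constant times the coroot. -/
theorem corootPoly_dvd (i : B) (f : MvPolynomial B ℝ) :
    corootPoly M i ∣ f - cs.polyAct (cs.simple i) f := by
  induction f using MvPolynomial.induction_on with
  | C a => simp [polyAct]
  | add p q hp hq =>
    rw [map_add, add_sub_add_comm]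
    exact dvd_add hp hq
  | mul_X p j hp =>
    have hX : corootPoly M i ∣ X j - cs.polyAct (cs.simple i) (X j) := by
      refine ⟨C (simpleRoot i j), MvPolynomial.funext fun v => ?_⟩
      simp [corootPoly, eval_polyAct, eval_linearPoly, simpleReflection_apply]
    have e : p * X j - cs.polyAct (cs.simple i) (p * X j) =
        (p - cs.polyAct (cs.simple i) p) * X j +
          cs.polyAct (cs.simple i) p * (X j - cs.polyAct (cs.simple i) (X j)) := by
      rw [map_mul]
      ring
    rw [e]
    exact dvd_add (hp.mul_right _) (hX.mul_left _)

/-- The divided difference (Demazure) operator `f ↦ (f - s f) / α^∨`. -/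
def demazure (i : B) : MvPolynomial B ℝ →ₗ[ℝ] MvPolynomial B ℝ where
  toFun f := (cs.corootPoly_dvd i f).choose
  map_add' f g := by
    apply mul_left_cancel₀ (corootPoly_ne_zero (M := M) i)
    rw [mul_add, ← (cs.corootPoly_dvd i f).choose_spec, ← (cs.corootPoly_dvd i g).choose_spec,
      ← (cs.corootPoly_dvd i (f + g)).choose_spec, map_add]
    ring
  map_smul' c f := by
    apply mul_left_cancel₀ (corootPoly_ne_zero (M := M) i)
    rw [RingHom.id_apply, mul_smul_comm, ← (cs.corootPoly_dvd i f).choose_spec,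
      ← (cs.corootPoly_dvd i (c • f)).choose_spec, map_smul, smul_sub]

theorem corootPoly_mul_demazure (i : B) (f : MvPolynomial B ℝ) :
    corootPoly M i * cs.demazure i f = f - cs.polyAct (cs.simple i) f :=
  (cs.corootPoly_dvd i f).choose_spec.symm

theorem eq_demazure {i : B} {f g : MvPolynomial B ℝ}
    (h : corootPoly M i * g = f - cs.polyAct (cs.simple i) f) : cs.demazure i f = g :=
  mul_left_cancel₀ (corootPoly_ne_zero (M := M) i) ((cs.corootPoly_mul_demazure i f).trans h.symm)

theorem demazure_mul (i : B) (f g : MvPolynomial B ℝ) :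
    cs.demazure i (f * g) =
      cs.demazure i f * g + cs.polyAct (cs.simple i) f * cs.demazure i g := by
  apply cs.eq_demazure
  rw [mul_add, ← mul_assoc, corootPoly_mul_demazure, mul_left_comm, corootPoly_mul_demazure,
    map_mul]
  ring

theorem demazure_invariant_mul (i : B) {f : MvPolynomial B ℝ} (hf : f ∈ cs.invariants)
    (g : MvPolynomial B ℝ) : cs.demazure i (f * g) = f * cs.demazure i g := by
  rw [demazure_mul, cs.mem_invariants_iff.1 hf, cs.eq_demazure (g := 0), zero_mul, zero_add]
  rw [cs.mem_invariants_iff.1 hf, mul_zero, sub_self]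

theorem demazure_C (i : B) (a : ℝ) : cs.demazure i (C a) = 0 := by
  apply cs.eq_demazure
  simp [polyAct]

/-- Both f - s f and the coroot change sign under s, so their quotient is s-invariant. -/
theorem demazure_demazure (i : B) (f : MvPolynomial B ℝ) :
    cs.demazure i (cs.demazure i f) = 0 := by
  apply cs.eq_demazure
  rw [mul_zero]
  apply mul_left_cancel₀ (corootPoly_ne_zero (M := M) i)
  have h : cs.polyAct (cs.simple i) (corootPoly M i) = -corootPoly M i := by
    refine MvPolynomial.funext fun v => ?_
    simp only [corootPoly, eval_polyAct, eval_linearPoly, inv_simple, geometricRep_simple,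
      simpleReflection_apply, map_sub, map_smul, simpleCoroot_simpleRoot_self, map_neg,
      smul_eq_mul]
    ring
  have h2 := congrArg (cs.polyAct (cs.simple i)) (cs.corootPoly_mul_demazure i f)
  rw [map_mul, h, map_sub, ← polyAct_mul_apply, simple_mul_simple_self, polyAct_one_apply] at h2
  rw [mul_zero, mul_sub, corootPoly_mul_demazure]
  linear_combination -h2

theorem demazure_polyAct_linearPoly (i : B) (w : W) (φ : Module.Dual ℝ (B → ℝ)) :
    cs.demazure i (cs.polyAct w (linearPoly φ)) =
      C (φ (cs.geometricRep w⁻¹ (simpleRoot i))) := by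
  apply cs.eq_demazure
  refine MvPolynomial.funext fun v => ?_
  simp [corootPoly, eval_polyAct, eval_linearPoly, simpleReflection_apply]

theorem isHomogeneous_demazure (i : B) {n : ℕ} {f : MvPolynomial B ℝ}
    (hf : f.IsHomogeneous (n + 1)) : (cs.demazure i f).IsHomogeneous n := by
  induction n generalizing f with
  | zero =>
    refine hf.mem_of_X_mul_mem ((homogeneousSubmodule B ℝ 0).comap (cs.demazure i))
      fun j g hg => ?_
    obtain ⟨a, rfl⟩ := hg.eq_C
    have h := cs.demazure_polyAct_linearPoly i 1 (LinearMap.proj j)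
    rw [polyAct_one_apply, ← X_eq_linearPoly] at h
    rw [Submodule.mem_comap, mem_homogeneousSubmodule, demazure_mul, demazure_C, mul_zero,
      add_zero, h, ← C_mul]
    exact isHomogeneous_C _ _
  | succ n ih =>
    refine hf.mem_of_X_mul_mem ((homogeneousSubmodule B ℝ (n + 1)).comap (cs.demazure i))
      fun j g hg => ?_
    have h := cs.demazure_polyAct_linearPoly i 1 (LinearMap.proj j)
    rw [polyAct_one_apply, ← X_eq_linearPoly] at h
    rw [Submodule.mem_comap, mem_homogeneousSubmodule, demazure_mul, h, X_eq_linearPoly,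
      polyAct_linearPoly]
    refine (hg.C_mul _).add ?_
    rw [add_comm]
    exact (isHomogeneous_linearPoly _).mul (ih hg)

/-- The composite of the divided difference operators along a word. -/
def demazureWord : List B → MvPolynomial B ℝ →ₗ[ℝ] MvPolynomial B ℝ
  | [] => LinearMap.id
  | i :: ω => cs.demazure i ∘ₗ demazureWord ω

theorem demazureWord_cons_apply (i : B) (ω : List B) (f : MvPolynomial B ℝ) :
    cs.demazureWord (i :: ω) f = cs.demazure i (cs.demazureWord ω f) := rfl

theorem demazureWord_append_apply (ω η : List B) (f : MvPolynomial B ℝ) :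
    cs.demazureWord (ω ++ η) f = cs.demazureWord ω (cs.demazureWord η f) := by
  induction ω with
  | nil => rfl
  | cons i ω ih => rw [List.cons_append, demazureWord_cons_apply, ih, demazureWord_cons_apply]

theorem demazureWord_invariant_mul (ω : List B) {f : MvPolynomial B ℝ} (hf : f ∈ cs.invariants)
    (g : MvPolynomial B ℝ) : cs.demazureWord ω (f * g) = f * cs.demazureWord ω g := by
  induction ω with
  | nil => rfl
  | cons i ω ih =>
    rw [demazureWord_cons_apply, ih, demazure_invariant_mul _ _ hf, demazureWord_cons_apply]

theorem isHomogeneous_demazureWord {ω : List B} {m : ℕ} {f : MvPolynomial B ℝ}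
    (hf : f.IsHomogeneous (ω.length + m)) : (cs.demazureWord ω f).IsHomogeneous m := by
  induction ω generalizing m with
  | nil => simpa [demazureWord] using hf
  | cons i ω ih =>
    refine cs.isHomogeneous_demazure i (ih ?_)
    rwa [List.length_cons, add_right_comm, add_assoc] at hf

theorem demazureWord_eq_zero {ω : List B} {n : ℕ} {f : MvPolynomial B ℝ}
    (hf : f.IsHomogeneous n) (hn : n < ω.length) : cs.demazureWord ω f = 0 := by
  induction ω with
  | nil => simp at hn
  | cons i ω ih =>
    rw [demazureWord_cons_apply]
    rcases Nat.lt_or_ge n ω.length with h | h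
    · rw [ih h, map_zero]
    · rw [List.length_cons] at hn
      obtain rfl : n = ω.length + 0 := by omega
      obtain ⟨a, ha⟩ := (cs.isHomogeneous_demazureWord hf).eq_C
      rw [ha, demazure_C]

/-- Iterated twisted Leibniz rule. Either no letter differentiates the linear form, or one letter
turns it into a scalar, namely φ at the root attached to that letter, and the remaining letters act
on f. -/
theorem demazureWord_linearPoly_mul (φ : Module.Dual ℝ (B → ℝ)) (ω : List B)
    (f : MvPolynomial B ℝ) :
    cs.demazureWord ω (linearPoly φ * f) =
      cs.polyAct (cs.wordProd ω) (linearPoly φ) * cs.demazureWord ω f +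
        ((cs.erasures ω).map fun p => φ p.1 • cs.demazureWord p.2 f).sum := by
  induction ω with
  | nil => simp [erasures, demazureWord, polyAct_one_apply]
  | cons i ω ih =>
    rw [demazureWord_cons_apply, ih, map_add, demazure_mul, demazure_polyAct_linearPoly,
      ← polyAct_mul_apply, ← wordProd_cons, erasures, List.map_cons, List.sum_cons, List.map_map,
      map_list_sum, List.map_map, smul_eq_C_mul, demazureWord_cons_apply,
      add_comm (C _ * _), add_assoc]
    congr 3
    refine List.map_congr_left fun p _ => ?_
    simp [demazureWord_cons_apply]

/-- Both claims are proved together by induction. If i ω is not reduced while ω is, then ω can be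
traded for a word starting with i, and ∂_i² = 0. For two reduced words of one element, agreement
spreads from p to X_j p: in the commutation formula the first term depends only on the product, and
the sum runs over the same inversions with shorter words. -/
theorem demazureWord_wellDefined (n : ℕ) :
    (∀ ω : List B, ω.length = n → ¬cs.IsReduced ω → cs.demazureWord ω = 0) ∧
    (∀ ω η : List B, ω.length = n → η.length = n → cs.wordProd ω = cs.wordProd η →
      cs.demazureWord ω = cs.demazureWord η) := by
  induction n with
  | zero =>
    constructor
    · intro ω hω h
      rw [List.length_eq_zero_iff] at hω
      subst hω
      exact absurd (by simp [IsReduced]) h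
    · intro ω η hω hη _
      rw [List.length_eq_zero_iff] at hω hη
      rw [hω, hη]
  | succ n ih =>
    obtain ⟨ih1, ih2⟩ := ih
    have hnonred : ∀ ω : List B, ω.length = n + 1 → ¬cs.IsReduced ω → cs.demazureWord ω = 0 := by
      intro ω hω h
      obtain ⟨i, ω, rfl⟩ := List.exists_cons_of_length_eq_add_one hω
      rw [List.length_cons, add_left_inj] at hω
      refine LinearMap.ext fun f => ?_
      rw [demazureWord_cons_apply]
      by_cases hr : cs.IsReduced ω
      · rw [IsReduced, wordProd_cons, List.length_cons] at h
        have hlen := (cs.length_simple_mul (cs.wordProd ω) i).resolve_left (by rwa [hr.eq])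
        obtain ⟨η, hη, he⟩ := cs.exists_isReduced (cs.simple i * cs.wordProd ω)
        have hηl : (i :: η).length = n := by
          rw [List.length_cons, ← hη.eq, ← he, hlen, hr.eq, hω]
        rw [ih2 ω (i :: η) hω hηl (by rw [wordProd_cons, ← he, simple_mul_simple_cancel_left]),
          demazureWord_cons_apply, demazure_demazure, LinearMap.zero_apply]
      · rw [ih1 ω hω hr, LinearMap.zero_apply, map_zero]
    refine ⟨hnonred, fun ω η hω hη he => ?_⟩
    by_cases hr : cs.IsReduced ω
    swap
    · have hr' : ¬cs.IsReduced η := by rwa [IsReduced, ← he, hη, ← hω]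
      rw [hnonred ω hω hr, hnonred η hη hr']
    have hr' : cs.IsReduced η := by rwa [IsReduced, ← he, hη, ← hω]
    classical
    -- The operator shared by all words of length n with a given product. Erased words need not be
    -- reduced; the induction hypothesis covers them too.
    let D : W → MvPolynomial B ℝ →ₗ[ℝ] MvPolynomial B ℝ := fun w =>
      if h : ∃ ζ : List B, ζ.length = n ∧ cs.wordProd ζ = w then cs.demazureWord h.choose else 0
    have hD : ∀ ζ : List B, ζ.length = n → cs.demazureWord ζ = D (cs.wordProd ζ) := by
      intro ζ hζ
      have h : ∃ ζ' : List B, ζ'.length = n ∧ cs.wordProd ζ' = cs.wordProd ζ := ⟨ζ, hζ, rfl⟩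
      simp only [D, dif_pos h]
      exact ih2 _ _ hζ h.choose_spec.1 h.choose_spec.2.symm
    have hsum : ∀ (ζ : List B) (f : MvPolynomial B ℝ) (φ : Module.Dual ℝ (B → ℝ)),
        ζ.length = n + 1 →
        ((cs.erasures ζ).map fun p => φ p.1 • cs.demazureWord p.2 f).sum =
          (((cs.erasures ζ).map Prod.fst).map fun β =>
            φ β • D (cs.wordProd ζ * cs.rootReflection β) f).sum := by
      intro ζ f φ hζ
      rw [List.map_map]
      congr 1
      refine List.map_congr_left fun p hp => ?_
      have := cs.length_of_mem_erasures hp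
      rw [hD _ (by omega), cs.wordProd_of_mem_erasures hp, Function.comp_apply]
    refine LinearMap.ext fun f => ?_
    induction f using MvPolynomial.induction_on with
    | C a =>
      rw [cs.demazureWord_eq_zero (isHomogeneous_C B a) (by omega),
        cs.demazureWord_eq_zero (isHomogeneous_C B a) (by omega)]
    | add p q hp hq => rw [map_add, map_add, hp, hq]
    | mul_X p j hp =>
      rw [mul_comm, X_eq_linearPoly, demazureWord_linearPoly_mul, demazureWord_linearPoly_mul,
        hp, hsum _ _ _ hω, hsum _ _ _ hη, he]
      congr 1
      exact ((cs.map_fst_erasures_perm hr hr' he).map _).sum_eq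

theorem demazureWord_eq_zero_of_not_isReduced {ω : List B} (h : ¬cs.IsReduced ω) :
    cs.demazureWord ω = 0 :=
  (cs.demazureWord_wellDefined _).1 ω rfl h

/-- The divided difference operator of a group element. -/
def demazureOp (w : W) : MvPolynomial B ℝ →ₗ[ℝ] MvPolynomial B ℝ :=
  cs.demazureWord (cs.exists_isReduced w).choose

theorem exists_demazureOp_eq (w : W) : ∃ ω : List B, cs.IsReduced ω ∧ cs.wordProd ω = w ∧
    ω.length = cs.length w ∧ cs.demazureOp w = cs.demazureWord ω := by
  have h := (cs.exists_isReduced w).choose_spec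
  refine ⟨_, h.1, h.2.symm, ?_, rfl⟩
  rw [← h.1.eq, ← h.2]

theorem demazureWord_eq_demazureOp {ω : List B} (h : cs.IsReduced ω) :
    cs.demazureWord ω = cs.demazureOp (cs.wordProd ω) := by
  obtain ⟨η, hη, he, hl, h'⟩ := cs.exists_demazureOp_eq (cs.wordProd ω)
  rw [h']
  exact (cs.demazureWord_wellDefined _).2 ω η rfl (by rw [hl, h.eq]) he.symm

theorem demazureOp_demazureOp (u w : W) (f : MvPolynomial B ℝ) :
    cs.demazureOp u (cs.demazureOp w f) =
      if cs.length (u * w) = cs.length u + cs.length w then cs.demazureOp (u * w) f else 0 := by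
  obtain ⟨ω, hω, rfl, hlω, h⟩ := cs.exists_demazureOp_eq u
  obtain ⟨η, hη, rfl, hlη, h'⟩ := cs.exists_demazureOp_eq w
  rw [h, h', ← demazureWord_append_apply, ← wordProd_append, ← hlω, ← hlη, ← List.length_append]
  split_ifs with hr
  · rw [demazureWord_eq_demazureOp cs hr]
  · rw [demazureWord_eq_zero_of_not_isReduced cs hr, LinearMap.zero_apply]

/-- The sum of the coordinates; it takes the value `1` on every simple root. -/
def heightPoly (B : Type*) [Fintype B] [DecidableEq B] : MvPolynomial B ℝ :=
  linearPoly (∑ j, LinearMap.proj j)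

theorem exists_list_sum_eq_C (l : List (MvPolynomial B ℝ)) (h : ∀ p ∈ l, ∃ c, 0 ≤ c ∧ p = C c) :
    ∃ c, 0 ≤ c ∧ l.sum = C c := by
  induction l with
  | nil => exact ⟨0, le_rfl, by simp⟩
  | cons p l ih =>
    obtain ⟨a, ha, rfl⟩ := h p List.mem_cons_self
    obtain ⟨b, hb, e⟩ := ih fun q hq => h q (List.mem_cons_of_mem _ hq)
    exact ⟨a + b, add_nonneg ha hb, by rw [List.sum_cons, e, C_add]⟩

/-- Splitting off one factor of the height leaves, by degree, only the sum over inversions. All its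
terms are nonnegative, and erasing the first letter leaves a reduced word and a positive height.
Applied to w₀, this gives a polynomial that ∂_{w₀} does not kill. -/
theorem exists_demazureWord_heightPoly_pow (ω : List B) :
    ∃ c : ℝ, 0 ≤ c ∧ cs.demazureWord ω (heightPoly B ^ ω.length) = C c ∧
      (cs.IsReduced ω → 0 < c) := by
  induction hn : ω.length generalizing ω with
  | zero =>
    rw [List.length_eq_zero_iff] at hn
    subst hn
    exact ⟨1, zero_le_one, by simp [demazureWord], fun _ => one_pos⟩
  | succ n ih =>
    by_cases hr : cs.IsReduced ω
    swap
    · refine ⟨0, le_rfl, ?_, fun h => absurd h hr⟩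
      rw [cs.demazureWord_eq_zero_of_not_isReduced hr, LinearMap.zero_apply, C_0]
    have hpos : ∀ p ∈ cs.erasures ω, ∃ c, 0 ≤ c ∧
        (∑ j, LinearMap.proj j : Module.Dual ℝ (B → ℝ)) p.1 •
          cs.demazureWord p.2 (heightPoly B ^ n) = C c := by
      intro p hp
      have hlen := cs.length_of_mem_erasures hp
      obtain ⟨c, hc, e, -⟩ := ih p.2 (by omega)
      obtain ⟨-, h0, -⟩ := (cs.mem_map_fst_erasures hr p.1).1 (List.mem_map_of_mem hp)
      refine ⟨(∑ j, LinearMap.proj j : Module.Dual ℝ (B → ℝ)) p.1 * c, mul_nonneg ?_ hc, ?_⟩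
      · simpa using Finset.sum_nonneg fun j _ => h0 j
      · rw [e, smul_eq_C_mul, C_mul]
    have hzero : cs.demazureWord ω (heightPoly B ^ n) = 0 :=
      cs.demazureWord_eq_zero (by simpa [heightPoly] using (isHomogeneous_linearPoly _).pow n)
        (by omega)
    rw [pow_succ', heightPoly, demazureWord_linearPoly_mul, ← heightPoly, hzero, mul_zero,
      zero_add]
    obtain ⟨i, ω, rfl⟩ := List.exists_cons_of_length_eq_add_one hn
    rw [erasures, List.map_cons, List.sum_cons]
    rw [erasures] at hpos
    obtain ⟨hr', h0⟩ := cs.isReduced_cons hr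
    rw [List.length_cons, add_left_inj] at hn
    obtain ⟨a, ha, ea, hap⟩ := ih ω hn
    obtain ⟨b, hb, eb⟩ := exists_list_sum_eq_C _ fun p hp => by
      obtain ⟨q, hq, rfl⟩ := List.mem_map.1 hp
      exact hpos q (List.mem_cons_of_mem _ hq)
    obtain ⟨h, hh⟩ : ∃ h, h = (∑ j, LinearMap.proj j : Module.Dual ℝ (B → ℝ))
      (cs.geometricRep (cs.wordProd ω)⁻¹ (simpleRoot i)) := ⟨_, rfl⟩
    have hpos' : 0 < h := by
      rw [hh, LinearMap.sum_apply]
      have hne := cs.geometricRep_ne_zero (cs.wordProd ω)⁻¹ (simpleRoot_ne_zero i)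
      obtain ⟨j, hj⟩ := Function.ne_iff.1 hne
      exact Finset.sum_pos' (fun j _ => h0 j)
        ⟨j, Finset.mem_univ j, lt_of_le_of_ne (h0 j) (Ne.symm hj)⟩
    have := mul_pos hpos' (hap hr')
    refine ⟨h * a + b, by positivity, ?_, fun _ => by positivity⟩
    rw [eb, ea, ← hh, smul_eq_C_mul, ← C_mul, ← C_add]

end CoxeterSystem

end

/-! ### Freeness of the polynomials over the invariants -/

noncomputable section

open CoxeterMatrix MvPolynomial

namespace CoxeterSystem

variable {B : Type*} [Fintype B] [DecidableEq B] {M : CoxeterMatrix B}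
  {W : Type*} [Group W] (cs : CoxeterSystem M W)

/-- Every s is a descent of w₀, so w₀ maps nonnegative vectors to nonpositive ones. Hence if s is a
descent of v, it is a descent of w₀ v s, and peeling such letters off v raises the length of w₀ v
one at a time. -/
theorem length_longest_mul_add {w₀ : W} (h : ∀ w, cs.length w ≤ cs.length w₀) (v : W) :
    cs.length (w₀ * v) + cs.length v = cs.length w₀ := by
  have hneg : ∀ x : B → ℝ, 0 ≤ x → cs.geometricRep w₀ x ≤ 0 := by
    intro x hx
    rw [eq_sum_simpleRoot x, map_sum]
    refine Finset.sum_nonpos fun i _ => ?_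
    rw [map_smul]
    refine smul_nonpos_of_nonneg_of_nonpos (hx i) (cs.geometricRep_simpleRoot_nonpos ?_)
    exact lt_of_le_of_ne (h _) (cs.length_mul_simple_ne w₀ i)
  induction hn : cs.length v generalizing v with
  | zero => rw [cs.length_eq_zero_iff.1 hn, mul_one, add_zero]
  | succ n ih =>
    have hv : v ≠ 1 := by
      rintro rfl
      simp at hn
    obtain ⟨s, hs⟩ := cs.exists_rightDescent_of_ne_one hv
    have hl := cs.isRightDescent_iff.1 hs
    have ih' := ih (v * cs.simple s) (by omega)
    have hd : cs.IsRightDescent (w₀ * (v * cs.simple s)) s := by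
      rw [isRightDescent_iff_nonpos, geometricRep_mul_apply]
      exact hneg _ (cs.geometricRep_simpleRoot_nonneg
        (cs.isRightDescent_iff_not_isRightDescent_mul.1 hs))
    have hl' := cs.isRightDescent_iff.1 hd
    rw [mul_assoc, mul_assoc, simple_mul_simple_self, mul_one] at hl'
    omega

theorem isHomogeneous_demazureOp {w : W} {m : ℕ} {f : MvPolynomial B ℝ}
    (hf : f.IsHomogeneous (cs.length w + m)) : (cs.demazureOp w f).IsHomogeneous m := by
  obtain ⟨ω, -, -, hl, h⟩ := cs.exists_demazureOp_eq w
  rw [h]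
  exact cs.isHomogeneous_demazureWord (by rwa [hl])

theorem demazureOp_eq_zero {w : W} {n : ℕ} {f : MvPolynomial B ℝ}
    (hf : f.IsHomogeneous n) (hn : n < cs.length w) : cs.demazureOp w f = 0 := by
  obtain ⟨ω, -, -, hl, h⟩ := cs.exists_demazureOp_eq w
  rw [h]
  exact cs.demazureWord_eq_zero hf (by rwa [hl])

theorem demazureOp_invariant_mul (w : W) {f : MvPolynomial B ℝ} (hf : f ∈ cs.invariants)
    (g : MvPolynomial B ℝ) : cs.demazureOp w (f * g) = f * cs.demazureOp w g :=
  cs.demazureWord_invariant_mul _ hf g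

/-- With N = ℓ(w₀), P_w is a multiple of ∂_{w⁻¹ w₀} applied to the N-th power of the height. For
ℓ(u) = ℓ(w), ∂_u P_w can survive only if u w⁻¹ w₀ has length N, which forces u = w. -/
theorem exists_dual_family [Finite W] :
    ∃ P : W → MvPolynomial B ℝ, (∀ w, (P w).IsHomogeneous (cs.length w)) ∧
      ∀ u w, cs.length u = cs.length w →
        cs.demazureOp u (P w) = open Classical in if u = w then 1 else 0 := by
  classical
  obtain ⟨w₀, h₀⟩ := Finite.exists_max cs.length
  have hcompl : ∀ w, cs.length (w⁻¹ * w₀) + cs.length w = cs.length w₀ := by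
    intro w
    -- The complement is needed on the other side, so the lemma is applied to w₀⁻¹, also of maximal
    -- length, and inverted.
    have := cs.length_longest_mul_add (w₀ := w₀⁻¹) (by simpa using h₀) w
    rwa [← cs.length_inv (w₀⁻¹ * w), mul_inv_rev, inv_inv, cs.length_inv w₀] at this
  obtain ⟨ω, hω, hωw, hl, hop⟩ := cs.exists_demazureOp_eq w₀
  obtain ⟨c, -, hc, hc0⟩ := cs.exists_demazureWord_heightPoly_pow ω
  rw [← hop, hl] at hc
  have hhom : (heightPoly B ^ cs.length w₀).IsHomogeneous (cs.length w₀) := by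
    simpa [heightPoly] using
      (isHomogeneous_linearPoly (∑ j : B, LinearMap.proj j)).pow (cs.length w₀)
  refine ⟨fun w => C c⁻¹ * cs.demazureOp (w⁻¹ * w₀) (heightPoly B ^ cs.length w₀), fun w => ?_,
    fun u w huw => ?_⟩
  · refine (cs.isHomogeneous_demazureOp ?_).C_mul _
    rwa [hcompl]
  · beta_reduce
    rw [← smul_eq_C_mul, map_smul, demazureOp_demazureOp]
    by_cases e : u = w
    · subst e
      rw [mul_inv_cancel_left, if_pos, if_pos rfl, hc, smul_eq_C_mul, ← C_mul,
        inv_mul_cancel₀ (hc0 hω).ne', C_1]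
      have := hcompl u
      omega
    · rw [if_neg, if_neg e, smul_zero]
      intro h
      have h1 := hcompl (w * u⁻¹)
      have h2 := hcompl w
      rw [mul_inv_rev, inv_inv, mul_assoc] at h1
      have h3 := cs.length_eq_zero_iff.1 (by omega : cs.length (w * u⁻¹) = 0)
      exact e (mul_inv_eq_one.1 h3).symm

/-- Since ∂_u kills degrees below ℓ(u), the matrix is block triangular by length, with identity
blocks on the diagonal. -/
theorem det_demazure_eq_one [Fintype W] [DecidableEq W] {P : W → MvPolynomial B ℝ}
    (hP : ∀ w, (P w).IsHomogeneous (cs.length w))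
    (hdual : ∀ u w, cs.length u = cs.length w → cs.demazureOp u (P w) = if u = w then 1 else 0) :
    (Matrix.of fun u w => cs.demazureOp u (P w)).det = 1 := by
  have hM : (Matrix.of fun u w => cs.demazureOp u (P w)).BlockTriangular cs.length :=
    fun u w h => cs.demazureOp_eq_zero (hP w) h
  rw [hM.det]
  refine Finset.prod_eq_one fun k _ => ?_
  have : (Matrix.of fun u w => cs.demazureOp u (P w)).toSquareBlock cs.length k = 1 := by
    ext1 u w
    rw [Matrix.toSquareBlock_def, Matrix.of_apply, Matrix.of_apply, hdual _ _ (u.2.trans w.2.symm),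
      Matrix.one_apply]
    simp only [Subtype.ext_iff]
  rw [this, Matrix.det_one]

theorem polyAct_ne_zero (w : W) {f : MvPolynomial B ℝ} (hf : f ≠ 0) : cs.polyAct w f ≠ 0 := by
  intro h
  apply hf
  rw [← cs.polyAct_one_apply f, ← inv_mul_cancel w, polyAct_mul_apply, h, map_zero]

/-- Because α_i^∨ ∂_i = 1 - s_i, relations valid for all group elements pass to divided differences
after cancelling a translated coroot. -/
theorem sum_demazureWord_eq_zero [Fintype W] {P e : W → MvPolynomial B ℝ}
    (h : ∀ u, ∑ w, e w * cs.polyAct u (P w) = 0) (ω : List B) (u : W) :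
    ∑ w, e w * cs.polyAct u (cs.demazureWord ω (P w)) = 0 := by
  induction ω generalizing u with
  | nil => exact h u
  | cons i ω ih =>
    apply mul_left_cancel₀ (cs.polyAct_ne_zero u (corootPoly_ne_zero (M := M) i))
    rw [mul_zero, Finset.mul_sum]
    have : ∀ w, cs.polyAct u (corootPoly M i) *
        (e w * cs.polyAct u (cs.demazureWord (i :: ω) (P w))) =
        e w * cs.polyAct u (cs.demazureWord ω (P w)) -
          e w * cs.polyAct (u * cs.simple i) (cs.demazureWord ω (P w)) := by
      intro w
      rw [demazureWord_cons_apply, mul_left_comm, ← map_mul, corootPoly_mul_demazure, map_sub,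
        polyAct_mul_apply, mul_sub]
    rw [Finset.sum_congr rfl fun w _ => this w, Finset.sum_sub_distrib, ih, ih, sub_zero]

/-- The reverse passage: s_i = 1 - α_i^∨ ∂_i, so an expansion respected by all divided differences
is respected by the group. -/
theorem eq_sum_polyAct [Fintype W] {P c : W → MvPolynomial B ℝ} {f : MvPolynomial B ℝ}
    (h : ∀ ω, cs.demazureWord ω f = ∑ w, c w * cs.demazureWord ω (P w)) (u : W) (ω : List B) :
    cs.polyAct u (cs.demazureWord ω f) = ∑ w, c w * cs.polyAct u (cs.demazureWord ω (P w)) := by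
  induction u using cs.simple_induction_right generalizing ω with
  | one => simpa [polyAct_one_apply] using h ω
  | mul_simple_right u i ih =>
    have key : ∀ g, cs.polyAct (u * cs.simple i) g =
        cs.polyAct u g - cs.polyAct u (corootPoly M i) * cs.polyAct u (cs.demazure i g) := by
      intro g
      rw [polyAct_mul_apply, ← map_mul, corootPoly_mul_demazure, map_sub, sub_sub_cancel]
    have hi := ih (i :: ω)
    simp only [demazureWord_cons_apply] at hi
    simp only [key, ih, hi, mul_sub, Finset.sum_sub_distrib, Finset.mul_sum]
    congr 1
    exact Finset.sum_congr rfl fun w _ => by ring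

/-- The polynomials are a free module over the invariants, with a homogeneous basis whose degrees
are the lengths of the group elements. -/
theorem exists_basis_invariants [Finite W] :
    ∃ b : Module.Basis W cs.invariants (MvPolynomial B ℝ),
      ∀ w, (b w).IsHomogeneous (cs.length w) := by
  classical
  have := Fintype.ofFinite W
  obtain ⟨P, hP, hdual⟩ := cs.exists_dual_family
  replace hdual : ∀ u w, cs.length u = cs.length w →
      cs.demazureOp u (P w) = if u = w then 1 else 0 := by
    intro u w h
    rw [hdual u w h]
  obtain ⟨A, hA⟩ : ∃ A : Matrix W W (MvPolynomial B ℝ),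
    A = Matrix.of fun u w => cs.demazureOp u (P w) := ⟨_, rfl⟩
  have hdet : A.det = 1 := hA ▸ cs.det_demazure_eq_one hP hdual
  have hAv : ∀ e u, (A.mulVec e) u = ∑ w, e w * cs.demazureOp u (P w) := by
    intro e u
    rw [hA, Matrix.mulVec, dotProduct]
    exact Finset.sum_congr rfl fun w _ => mul_comm _ _
  have hinj : ∀ e, A.mulVec e = 0 → e = 0 := fun e he =>
    Matrix.eq_zero_of_mulVec_eq_zero (by rw [hdet]; exact one_ne_zero) he
  have hli : LinearIndependent cs.invariants P := by
    rw [Fintype.linearIndependent_iff]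
    intro g hg w
    have : (fun w => (g w : MvPolynomial B ℝ)) = 0 := by
      apply hinj
      ext1 u
      rw [hAv, Pi.zero_apply, ← map_zero (cs.demazureOp u), ← hg, map_sum]
      exact Finset.sum_congr rfl fun w _ =>
        (cs.demazureOp_invariant_mul u (g w).2 (P w)).symm
    exact Subtype.ext (congrFun this w)
  have hspan : ⊤ ≤ Submodule.span cs.invariants (Set.range P) := by
    rintro f -
    -- Determinant 1 lets the system be solved with polynomial coefficients; their invariance is
    -- proved afterwards.
    obtain ⟨c, hc⟩ : ∃ c, A.mulVec c = fun u => cs.demazureOp u f :=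
      ⟨A⁻¹.mulVec fun u => cs.demazureOp u f, by
        rw [Matrix.mulVec_mulVec, Matrix.mul_nonsing_inv _ (by rw [hdet]; exact isUnit_one),
          Matrix.one_mulVec]⟩
    have hword : ∀ ω, cs.demazureWord ω f = ∑ w, c w * cs.demazureWord ω (P w) := by
      intro ω
      by_cases hr : cs.IsReduced ω
      · rw [cs.demazureWord_eq_demazureOp hr, ← hAv, hc]
      · simp [cs.demazureWord_eq_zero_of_not_isReduced hr]
    have hact : ∀ u, cs.polyAct u f = ∑ w, c w * cs.polyAct u (P w) :=
      fun u => cs.eq_sum_polyAct hword u []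
    have hinv : ∀ w, c w ∈ cs.invariants := by
      intro w
      rw [mem_invariants_iff]
      intro v
      -- Translating the expansion of v⁻¹ u f by v gives a second expansion of u f; the two are
      -- subtracted, and injectivity of the matrix then kills the difference of coefficients.
      have hz : ∀ u, ∑ w, (cs.polyAct v (c w) - c w) * cs.polyAct u (P w) = 0 := by
        intro u
        simp only [sub_mul, Finset.sum_sub_distrib]
        rw [← hact, sub_eq_zero]
        have h1 := congrArg (cs.polyAct v) (hact (v⁻¹ * u))
        simp only [map_sum, map_mul, ← polyAct_mul_apply, mul_inv_cancel_left] at h1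
        exact h1.symm
      have : (fun w => cs.polyAct v (c w) - c w) = 0 := by
        apply hinj
        ext1 u
        rw [hAv, Pi.zero_apply]
        obtain ⟨ω, -, -, -, h⟩ := cs.exists_demazureOp_eq u
        have := cs.sum_demazureWord_eq_zero hz ω 1
        simpa only [polyAct_one_apply, ← h] using this
      exact sub_eq_zero.1 (congrFun this w)
    have hf : f = ∑ w, (⟨c w, hinv w⟩ : cs.invariants) • P w := by
      have := hact 1
      simp only [polyAct_one_apply] at this
      exact this
    rw [hf]
    exact Submodule.sum_mem _ fun w _ =>
      Submodule.smul_mem _ _ (Submodule.subset_span ⟨w, rfl⟩)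
  exact ⟨Module.Basis.mk hli hspan, fun w => by rw [Module.Basis.mk_apply]; exact hP w⟩

end CoxeterSystem

end

/-! ### Hilbert series and the product formula -/

noncomputable section

open MvPolynomial

namespace MvPolynomial

variable {σ ι : Type*}

theorem span_range_homogeneous_basis (b : Module.Basis ι ℝ (MvPolynomial σ ℝ)) {D : ι → ℕ}
    (h : ∀ i, (b i).IsHomogeneous (D i)) (k : ℕ) :
    Submodule.span ℝ (Set.range fun i : {i // D i = k} => b i) = homogeneousSubmodule σ ℝ k := by
  apply le_antisymm
  · rw [Submodule.span_le]
    rintro _ ⟨⟨i, rfl⟩, rfl⟩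
    exact h i
  · intro f hf
    have e : f = (b.repr f).sum fun i c => c • homogeneousComponent k (b i) := by
      conv_lhs => rw [← homogeneousComponent_eq_self hf, ← b.linearCombination_repr f,
        Finsupp.linearCombination_apply, Finsupp.sum, map_sum]
      simp only [map_smul]
      rfl
    rw [e]
    refine Submodule.sum_mem _ fun i _ => Submodule.smul_mem _ _ ?_
    rw [homogeneousComponent_of_mem (h i)]
    split_ifs with hk
    · exact Submodule.subset_span ⟨⟨i, hk.symm⟩, rfl⟩
    · exact Submodule.zero_mem _

/-- The count in each degree is intrinsic, which permits comparing two homogeneous bases without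
Hilbert series machinery. -/
theorem natCard_homogeneous_basis (b : Module.Basis ι ℝ (MvPolynomial σ ℝ)) {D : ι → ℕ}
    (h : ∀ i, (b i).IsHomogeneous (D i)) (k : ℕ) :
    Nat.card {i // D i = k} = Module.finrank ℝ (homogeneousSubmodule σ ℝ k) := by
  have hli : LinearIndependent ℝ fun i : {i // D i = k} => b i :=
    b.linearIndependent.comp _ Subtype.val_injective
  rw [← span_range_homogeneous_basis b h]
  exact (Module.finrank_eq_nat_card_basis (Module.Basis.span hli)).symm

theorem finite_homogeneous_basis [Finite σ] (b : Module.Basis ι ℝ (MvPolynomial σ ℝ)) {D : ι → ℕ}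
    (h : ∀ i, (b i).IsHomogeneous (D i)) (k : ℕ) : Finite {i // D i = k} := by
  have hli : LinearIndependent ℝ fun i : {i // D i = k} => b i :=
    b.linearIndependent.comp _ Subtype.val_injective
  have hfg : (Submodule.span ℝ (Set.range fun i : {i // D i = k} => b i)).FG := by
    rw [span_range_homogeneous_basis b h]
    exact homogeneousSubmodule_fg σ ℝ k
  have := Module.Finite.iff_fg.2 hfg
  exact Module.Finite.finite_basis (Module.Basis.span hli)

end MvPolynomial

/-- Two functions to `ℕ` whose fibres are equinumerous differ by a bijection of their domains. -/
theorem exists_equiv_of_natCard_fiber_eq {ι κ : Type*} {D : ι → ℕ} {E : κ → ℕ}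
    (hD : ∀ k, Finite {i // D i = k}) (hE : ∀ k, Finite {j // E j = k})
    (h : ∀ k, Nat.card {i // D i = k} = Nat.card {j // E j = k}) :
    ∃ e : ι ≃ κ, ∀ i, E (e i) = D i := by
  have he : ∀ k, Nonempty ({i // D i = k} ≃ {j // E j = k}) := fun k =>
    Finite.card_eq.1 (h k)
  let e := fun k => (he k).some
  refine ⟨(Equiv.sigmaFiberEquiv D).symm.trans
    ((Equiv.sigmaCongrRight e).trans (Equiv.sigmaFiberEquiv E)), fun i => ?_⟩
  exact (e (D i) ⟨i, rfl⟩).2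

theorem ENNReal.tsum_pi_prod_pow {n : ℕ} (x : Fin n → ENNReal) :
    ∑' a : Fin n → ℕ, ∏ i, x i ^ a i = ∏ i, (1 - x i)⁻¹ := by
  induction n with
  | zero => simp
  | succ n ih =>
    rw [← (Fin.consEquiv fun _ => ℕ).tsum_eq, Fin.prod_univ_succ, ← ENNReal.tsum_geometric,
      ← ih fun i => x i.succ, ← ENNReal.tsum_mul_right]
    simp only [← ENNReal.tsum_mul_left]
    rw [← ENNReal.tsum_prod]
    refine tsum_congr fun p => ?_
    simp [Fin.consEquiv, Fin.prod_univ_succ]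

/-- The degree series of monomials in variables of degrees d_i. Values in `ENNReal` remove all
convergence questions. -/
theorem ENNReal.tsum_finsupp_pow {ι : Type*} [Fintype ι] (d : ι → ℕ) (q : ENNReal) :
    ∑' a : ι →₀ ℕ, q ^ (∑ i, d i * a i) = ∏ i, (1 - q ^ d i)⁻¹ := by
  rw [← Finsupp.equivFunOnFinite.symm.tsum_eq,
    ← (Equiv.arrowCongr (Fintype.equivFin ι) (Equiv.refl ℕ)).symm.tsum_eq,
    ← (Fintype.equivFin ι).symm.prod_comp,
    ← ENNReal.tsum_pi_prod_pow fun j => q ^ d ((Fintype.equivFin ι).symm j)]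
  refine tsum_congr fun a => ?_
  rw [← (Fintype.equivFin ι).symm.sum_comp, ← Finset.prod_pow_eq_pow_sum]
  refine Finset.prod_congr rfl fun j _ => ?_
  simp [pow_mul]

namespace CoxeterSystem

variable {B : Type*} [Fintype B] [DecidableEq B] {M : CoxeterMatrix B}
  {W : Type*} [Group W] (cs : CoxeterSystem M W)

variable {cs} in
theorem IsDegrees.pos {d : Fin (Fintype.card B) → ℕ} (hd : cs.IsDegrees d)
    (i : Fin (Fintype.card B)) : 0 < d i := by
  obtain ⟨f, hf, hind, -⟩ := hd
  rw [Nat.pos_iff_ne_zero]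
  intro h0
  have := hf i
  rw [h0] at this
  obtain ⟨a, ha⟩ := this.eq_C
  refine hind.transcendental i ?_
  rw [ha]
  exact isAlgebraic_algebraMap a

variable {cs} in
-- Monomials in the basic invariants form a basis of the invariants over ℝ; they are multiplied by
-- the basis of polynomials over the invariants.
theorem IsDegrees.exists_basis [Finite W] {d : Fin (Fintype.card B) → ℕ} (hd : cs.IsDegrees d) :
    ∃ b : Module.Basis ((Fin (Fintype.card B) →₀ ℕ) × W) ℝ (MvPolynomial B ℝ),
      ∀ p, (b p).IsHomogeneous (∑ i, d i * p.1 i + cs.length p.2) := by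
  obtain ⟨f, hf, hind, hadj⟩ := hd
  obtain ⟨b, hb⟩ := cs.exists_basis_invariants
  refine ⟨((basisMonomials _ ℝ).map (hind.aevalEquiv.trans
    (Subalgebra.equivOfEq _ _ hadj)).toLinearEquiv).smulTower b, fun p => ?_⟩
  rw [Module.Basis.smulTower_apply, Subalgebra.smul_def, smul_eq_mul]
  refine IsHomogeneous.mul ?_ (hb _)
  have e : (((basisMonomials _ ℝ).map (hind.aevalEquiv.trans
    (Subalgebra.equivOfEq _ _ hadj)).toLinearEquiv p.1 : cs.invariants) : MvPolynomial B ℝ) =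
      ∏ i, f i ^ p.1 i := by
    rw [Module.Basis.map_apply, coe_basisMonomials]
    change ((hind.aevalEquiv (monomial p.1 1) : Algebra.adjoin ℝ (Set.range f)) :
      MvPolynomial B ℝ) = _
    rw [hind.aevalEquiv_apply_coe, aeval_monomial, map_one, one_mul,
      Finsupp.prod_fintype _ _ fun i => pow_zero _]
  rw [e]
  exact IsHomogeneous.prod _ _ _ fun i _ => (hf i).pow _

variable {cs} in
theorem IsDegrees.tsum_eq [Fintype W] {d : Fin (Fintype.card B) → ℕ} (hd : cs.IsDegrees d)
    (q : ENNReal) :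
    ((1 - q)⁻¹) ^ Fintype.card B = (∏ i, (1 - q ^ d i)⁻¹) * ∑ w : W, q ^ cs.length w := by
  obtain ⟨b, hb⟩ := hd.exists_basis
  have hm : ∀ a, (basisMonomials B ℝ a).IsHomogeneous (∑ i, 1 * a i) := by
    intro a
    rw [coe_basisMonomials]
    refine isHomogeneous_monomial _ ?_
    simp [Finsupp.degree_eq_sum]
  obtain ⟨e, he⟩ := exists_equiv_of_natCard_fiber_eq
    (finite_homogeneous_basis _ hm) (finite_homogeneous_basis b hb)
    fun k => (natCard_homogeneous_basis _ hm k).trans (natCard_homogeneous_basis b hb k).symm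
  have h1 := ENNReal.tsum_finsupp_pow (fun _ : B => 1) q
  simp only [pow_one, Finset.prod_const, Finset.card_univ] at h1
  have h2 := ENNReal.tsum_finsupp_pow d q
  rw [← h1, ← h2, ← tsum_fintype (L := .unconditional W), ← ENNReal.tsum_mul_right]
  simp only [← ENNReal.tsum_mul_left]
  rw [← ENNReal.tsum_prod, ← e.tsum_eq]
  refine tsum_congr fun a => ?_
  rw [← he a, pow_add]

variable {cs} in
theorem IsDegrees.poincare_eq_of_lt_one [Fintype W] {d : Fin (Fintype.card B) → ℕ}
    (hd : cs.IsDegrees d) {q : ℝ} (h0 : 0 < q) (h1 : q < 1) :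
    cs.poincare q = ∏ i, ∑ k ∈ Finset.range (d i), q ^ k := by
  have h := congrArg ENNReal.toReal (hd.tsum_eq (ENNReal.ofReal q))
  have hpow : ∀ m : ℕ, 0 < m → (1 - ENNReal.ofReal q ^ m)⁻¹.toReal = (1 - q ^ m)⁻¹ := by
    intro m hm
    rw [ENNReal.toReal_inv, ← ENNReal.ofReal_pow h0.le, ← ENNReal.ofReal_one,
      ← ENNReal.ofReal_sub _ (by positivity), ENNReal.toReal_ofReal]
    exact sub_nonneg.2 (pow_le_one₀ h0.le h1.le)
  have hp1 := hpow 1 one_pos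
  rw [pow_one, pow_one] at hp1
  rw [ENNReal.toReal_pow, ENNReal.toReal_mul, ENNReal.toReal_prod, hp1,
    ENNReal.toReal_sum fun w _ => ENNReal.pow_ne_top ENNReal.ofReal_ne_top] at h
  simp only [hpow _ (hd.pos _), ENNReal.toReal_pow, ENNReal.toReal_ofReal h0.le] at h
  have hne : ∀ i, 1 - q ^ d i ≠ 0 := fun i =>
    (sub_pos.2 (pow_lt_one₀ h0.le h1 (hd.pos i).ne')).ne'
  have hq : 1 - q ≠ 0 := (sub_pos.2 h1).ne'
  have hgeom : ∏ i, ∑ k ∈ Finset.range (d i), q ^ k =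
      (∏ i, (1 - q ^ d i)) * ((1 - q)⁻¹) ^ Fintype.card B := by
    have : ∀ i, ∑ k ∈ Finset.range (d i), q ^ k = (1 - q ^ d i) * (1 - q)⁻¹ := by
      intro i
      rw [geom_sum_eq h1.ne, ← neg_sub 1 (q ^ d i), ← neg_sub 1 q, neg_div_neg_eq, div_eq_mul_inv]
    simp only [this, Finset.prod_mul_distrib, Finset.prod_const, Finset.card_univ,
      Fintype.card_fin]
  rw [hgeom, h, ← mul_assoc, ← Finset.prod_mul_distrib]
  simp only [mul_inv_cancel₀ (hne _), Finset.prod_const_one, one_mul]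
  rfl

variable {cs} in
/-- The generating function of the length, as an identity of polynomials. -/
theorem IsDegrees.poincare_polynomial_eq [Fintype W] {d : Fin (Fintype.card B) → ℕ}
    (hd : cs.IsDegrees d) :
    ∑ w : W, (Polynomial.X : Polynomial ℝ) ^ cs.length w =
      ∑ a : (i : Fin (Fintype.card B)) → Fin (d i), Polynomial.X ^ ∑ i, (a i : ℕ) := by
  apply Polynomial.eq_of_infinite_eval_eq
  -- The series argument needs q < 1, but agreement on the infinite set (0, 1) determines the
  -- polynomials.
  refine (Set.Ioo_infinite (zero_lt_one' ℝ)).mono fun q hq => ?_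
  have := hd.poincare_eq_of_lt_one hq.1 hq.2
  simp only [Finset.sum_range] at this
  rw [Finset.prod_univ_sum, Fintype.piFinset_univ] at this
  simp only [Set.mem_ofPred_eq, Polynomial.eval_finsetSum, Polynomial.eval_prod,
    Polynomial.eval_pow, Polynomial.eval_X, ← Finset.prod_pow_eq_pow_sum]
  exact this

variable {cs} in
/-- There is a bijection of the group with a product of intervals that turns the length into the sum
of the coordinates. -/
theorem IsDegrees.exists_equiv [Finite W] {d : Fin (Fintype.card B) → ℕ}
    (hd : cs.IsDegrees d) :
    ∃ e : W ≃ ((i : Fin (Fintype.card B)) → Fin (d i)),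
      ∀ w, ∑ i, (e w i : ℕ) = cs.length w := by
  classical
  have := Fintype.ofFinite W
  refine exists_equiv_of_natCard_fiber_eq
    (E := fun a : (i : Fin (Fintype.card B)) → Fin (d i) => ∑ i, (a i : ℕ))
    (fun k => inferInstance) (fun k => inferInstance) fun k => ?_
  have h := congrArg (fun p => p.coeff k) hd.poincare_polynomial_eq
  simp only [Polynomial.finsetSum_coeff, Polynomial.coeff_X_pow, Finset.sum_boole,
    Nat.cast_inj] at h
  rw [Nat.card_eq_fintype_card, Nat.card_eq_fintype_card, Fintype.card_subtype,
    Fintype.card_subtype]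
  simpa only [eq_comm] using h

end CoxeterSystem

end

/-! ### Truncated geometric distributions -/

noncomputable section

/-- The truncated geometric distribution on `{0, …, d - 1}`, with masses proportional to `q ^ k`. -/
def truncatedGeometric (d : ℕ) (q : ℝ) : Measure (Fin d) :=
  ∑ k : Fin d, ENNReal.ofReal (q ^ (k : ℕ) / ∑ k ∈ Finset.range d, q ^ k) • Measure.dirac k

theorem sum_range_pow_pos {d : ℕ} (hd : 0 < d) {q : ℝ} (hq : 0 < q) :
    0 < ∑ k ∈ Finset.range d, q ^ k :=
  Finset.sum_pos (fun _ _ => pow_pos hq _) (Finset.nonempty_range_iff.2 hd.ne')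

theorem sum_smul_dirac_singleton {α : Type*} [Fintype α] [MeasurableSpace α]
    [MeasurableSingletonClass α] (f : α → ENNReal) (a : α) :
    (∑ b, f b • Measure.dirac b : Measure α) {a} = f a := by
  classical
  rw [Measure.finsetSum_apply, Finset.sum_eq_single a]
  · simp
  · intro b _ hb
    simp [hb]
  · simp

theorem isProbabilityMeasure_sum_smul_dirac {α : Type*} [Fintype α] [MeasurableSpace α]
    {f : α → ℝ} (hf : ∀ a, 0 ≤ f a) (h : ∑ a, f a = 1) :
    IsProbabilityMeasure (∑ b, ENNReal.ofReal (f b) • Measure.dirac b : Measure α) := by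
  constructor
  rw [Measure.finsetSum_apply]
  simp only [Measure.smul_apply, measure_univ, smul_eq_mul, mul_one]
  rw [← ENNReal.ofReal_sum_of_nonneg fun a _ => hf a, h, ENNReal.ofReal_one]

theorem integral_sum_smul_dirac {α : Type*} [Fintype α] [MeasurableSpace α]
    [MeasurableSingletonClass α] {f : α → ℝ} (hf : ∀ a, 0 ≤ f a) (g : α → ℝ) :
    ∫ a, g a ∂(∑ b, ENNReal.ofReal (f b) • Measure.dirac b : Measure α) = ∑ a, f a * g a := by
  rw [integral_finsetSum_measure]
  · refine Finset.sum_congr rfl fun a _ => ?_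
    rw [integral_smul_measure, integral_dirac, ENNReal.toReal_ofReal (hf a), smul_eq_mul]
  · intro a _
    exact (integrable_dirac (by simp)).smul_measure ENNReal.ofReal_ne_top

theorem isProbabilityMeasure_truncatedGeometric {d : ℕ} (hd : 0 < d) {q : ℝ} (hq : 0 < q) :
    IsProbabilityMeasure (truncatedGeometric d q) := by
  have h := sum_range_pow_pos hd hq
  refine isProbabilityMeasure_sum_smul_dirac (fun k => by positivity) ?_
  rw [← Finset.sum_div, ← Finset.sum_range fun k => q ^ k, div_self h.ne']

theorem integral_truncatedGeometric {d : ℕ} (hd : 0 < d) {q : ℝ} (hq : 0 < q) (g : ℕ → ℝ) :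
    ∫ k, g (k : ℕ) ∂(truncatedGeometric d q) =
      (∑ k ∈ Finset.range d, q ^ k * g k) / ∑ k ∈ Finset.range d, q ^ k := by
  have h := sum_range_pow_pos hd hq
  rw [truncatedGeometric, integral_sum_smul_dirac (fun k => by positivity), Finset.sum_div,
    Finset.sum_range fun k => q ^ k * g k / _]
  exact Finset.sum_congr rfl fun k _ => div_mul_eq_mul_div _ _ _

/-- Denominators are cleared so that each induction step is a ring identity. -/
theorem sum_range_pow_mul_id (q : ℝ) (d : ℕ) :
    (∑ k ∈ Finset.range d, q ^ k * (k : ℝ)) * (1 - q) ^ 2 =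
      q * (1 - q ^ d) - d * q ^ d * (1 - q) := by
  induction d with
  | zero => simp
  | succ d ih =>
    rw [Finset.sum_range_succ, add_mul, ih]
    push_cast
    ring

theorem sum_range_pow_mul_sq (q : ℝ) (d : ℕ) :
    (∑ k ∈ Finset.range d, q ^ k * (k : ℝ) ^ 2) * (1 - q) ^ 3 =
      (q + q ^ 2) * (1 - q ^ d) - 2 * d * q * q ^ d * (1 - q) - d ^ 2 * q ^ d * (1 - q) ^ 2 := by
  induction d with
  | zero => simp
  | succ d ih =>
    rw [Finset.sum_range_succ, add_mul, ih]
    push_cast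
    ring

theorem one_sub_pow_ne_zero {d : ℕ} (hd : 0 < d) {q : ℝ} (hq : 0 < q) (hq1 : q ≠ 1) :
    1 - q ^ d ≠ 0 := by
  rw [sub_ne_zero]
  exact fun h => hq1 ((pow_eq_one_iff_of_nonneg hq.le hd.ne').1 h.symm)

theorem integral_id_truncatedGeometric {d : ℕ} (hd : 0 < d) {q : ℝ} (hq : 0 < q) (hq1 : q ≠ 1) :
    ∫ k, ((k : ℕ) : ℝ) ∂(truncatedGeometric d q) = q / (1 - q) - d * q ^ d / (1 - q ^ d) := by
  have h1 : 1 - q ≠ 0 := sub_ne_zero.2 (Ne.symm hq1)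
  have h2 := one_sub_pow_ne_zero hd hq hq1
  have h0 : ∑ k ∈ Finset.range d, q ^ k = (1 - q ^ d) / (1 - q) := by
    rw [geom_sum_eq hq1, ← neg_div_neg_eq, neg_sub, neg_sub]
  have hs := eq_div_of_mul_eq (pow_ne_zero 2 h1) (sum_range_pow_mul_id q d)
  rw [integral_truncatedGeometric hd hq fun k => (k : ℝ), h0, hs]
  field_simp

theorem integral_sq_truncatedGeometric {d : ℕ} (hd : 0 < d) {q : ℝ} (hq : 0 < q) (hq1 : q ≠ 1) :
    ∫ k, ((k : ℕ) : ℝ) ^ 2 ∂(truncatedGeometric d q) =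
      (q + q ^ 2) / (1 - q) ^ 2 - 2 * d * q * q ^ d / ((1 - q) * (1 - q ^ d)) -
        d ^ 2 * q ^ d / (1 - q ^ d) := by
  have h1 : 1 - q ≠ 0 := sub_ne_zero.2 (Ne.symm hq1)
  have h2 := one_sub_pow_ne_zero hd hq hq1
  have h0 : ∑ k ∈ Finset.range d, q ^ k = (1 - q ^ d) / (1 - q) := by
    rw [geom_sum_eq hq1, ← neg_div_neg_eq, neg_sub, neg_sub]
  have hs := eq_div_of_mul_eq (pow_ne_zero 3 h1) (sum_range_pow_mul_sq q d)
  rw [integral_truncatedGeometric hd hq fun k => (k : ℝ) ^ 2, h0, hs]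
  field_simp

theorem variance_truncatedGeometric {d : ℕ} (hd : 0 < d) {q : ℝ} (hq : 0 < q) (hq1 : q ≠ 1) :
    Var[fun k : Fin d => ((k : ℕ) : ℝ); truncatedGeometric d q] =
      q / (1 - q) ^ 2 - d ^ 2 * q ^ d / (1 - q ^ d) ^ 2 := by
  have := isProbabilityMeasure_truncatedGeometric hd hq
  have h1 : 1 - q ≠ 0 := sub_ne_zero.2 (Ne.symm hq1)
  have h2 := one_sub_pow_ne_zero hd hq hq1
  rw [variance_eq_sub MemLp.of_discrete]
  simp only [Pi.pow_apply]
  rw [integral_id_truncatedGeometric hd hq hq1, integral_sq_truncatedGeometric hd hq hq1]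
  field_simp
  ring

/-! ### The law of the length -/

namespace CoxeterSystem

variable {B : Type*} [Fintype B] [DecidableEq B] {M : CoxeterMatrix B}
  {W : Type*} [Group W] [Fintype W] {cs : CoxeterSystem M W}

theorem poincare_pos (cs : CoxeterSystem M W) {q : ℝ} (hq : 0 < q) : 0 < cs.poincare q :=
  Finset.sum_pos (fun _ _ => pow_pos hq _) Finset.univ_nonempty

theorem isProbabilityMeasure_mallows (cs : CoxeterSystem M W) [MeasurableSpace W] {q : ℝ}
    (hq : 0 < q) : IsProbabilityMeasure (cs.mallows q) := by
  have h := cs.poincare_pos hq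
  refine isProbabilityMeasure_sum_smul_dirac (fun w => by positivity) ?_
  rw [← Finset.sum_div]
  exact div_self h.ne'

/-- Read off from the bijection, the factorization holds for every real q, beyond the range of the
series. -/
theorem poincare_eq_prod {d : Fin (Fintype.card B) → ℕ}
    (e : W ≃ ((i : Fin (Fintype.card B)) → Fin (d i)))
    (he : ∀ w, ∑ i, (e w i : ℕ) = cs.length w) (q : ℝ) :
    cs.poincare q = ∏ i, ∑ k ∈ Finset.range (d i), q ^ k := by
  simp only [Finset.sum_range]
  rw [Finset.prod_univ_sum, Fintype.piFinset_univ, ← e.sum_comp, poincare]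
  refine Finset.sum_congr rfl fun w _ => ?_
  rw [Finset.prod_pow_eq_pow_sum, he]

variable [MeasurableSpace W] [MeasurableSingletonClass W]

/-- On singletons, numerator and normalizing constant both factor over the coordinates. -/
theorem map_mallows_eq_pi {d : Fin (Fintype.card B) → ℕ} (hd : ∀ i, 0 < d i)
    (e : W ≃ ((i : Fin (Fintype.card B)) → Fin (d i)))
    (he : ∀ w, ∑ i, (e w i : ℕ) = cs.length w) {q : ℝ} (hq : 0 < q) :
    (cs.mallows q).map e = Measure.pi fun i => truncatedGeometric (d i) q := by
  have := fun i => isProbabilityMeasure_truncatedGeometric (hd i) hq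
  refine Measure.ext_of_singleton fun a => ?_
  obtain ⟨w, rfl⟩ := e.surjective a
  have hpre : e ⁻¹' {e w} = {w} := by
    ext x
    simp
  rw [Measure.map_apply (measurable_of_finite _) (measurableSet_singleton _), hpre,
    Measure.pi_singleton, mallows, sum_smul_dirac_singleton, poincare_eq_prod e he, ← he,
    ← Finset.prod_pow_eq_pow_sum, ← Finset.prod_div_distrib, ENNReal.ofReal_prod_of_nonneg]
  · refine Finset.prod_congr rfl fun i _ => ?_
    rw [truncatedGeometric, sum_smul_dirac_singleton]
  · intro i _
    have := sum_range_pow_pos (hd i) hq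
    positivity

theorem map_mallows_coordinate {d : Fin (Fintype.card B) → ℕ} (hd : ∀ i, 0 < d i)
    (e : W ≃ ((i : Fin (Fintype.card B)) → Fin (d i)))
    (he : ∀ w, ∑ i, (e w i : ℕ) = cs.length w) {q : ℝ} (hq : 0 < q) (i : Fin (Fintype.card B)) :
    (cs.mallows q).map (fun w => e w i) = truncatedGeometric (d i) q := by
  have := fun i => isProbabilityMeasure_truncatedGeometric (hd i) hq
  rw [← (measurePreserving_eval (fun i => truncatedGeometric (d i) q) i).map_eq,
    ← map_mallows_eq_pi hd e he hq, Measure.map_map (measurable_pi_apply i)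
    (measurable_of_finite _)]
  rfl

theorem iIndepFun_coordinates {d : Fin (Fintype.card B) → ℕ} (hd : ∀ i, 0 < d i)
    (e : W ≃ ((i : Fin (Fintype.card B)) → Fin (d i)))
    (he : ∀ w, ∑ i, (e w i : ℕ) = cs.length w) {q : ℝ} (hq : 0 < q) :
    iIndepFun (fun i w => e w i) (cs.mallows q) := by
  have := cs.isProbabilityMeasure_mallows hq
  rw [iIndepFun_iff_map_fun_eq_pi_map fun i => (measurable_of_finite _).aemeasurable]
  simp only [map_mallows_coordinate hd e he hq]
  exact map_mallows_eq_pi hd e he hq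

theorem integral_coordinate {d : Fin (Fintype.card B) → ℕ} (hd : ∀ i, 0 < d i)
    (e : W ≃ ((i : Fin (Fintype.card B)) → Fin (d i)))
    (he : ∀ w, ∑ i, (e w i : ℕ) = cs.length w) {q : ℝ} (hq : 0 < q) (i : Fin (Fintype.card B))
    (g : ℕ → ℝ) :
    ∫ w, g (e w i) ∂(cs.mallows q) = ∫ k, g (k : ℕ) ∂(truncatedGeometric (d i) q) := by
  rw [← map_mallows_coordinate hd e he hq i, integral_map (measurable_of_finite _).aemeasurable
    (measurable_of_finite _).aestronglyMeasurable]

theorem variance_coordinate {d : Fin (Fintype.card B) → ℕ} (hd : ∀ i, 0 < d i)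
    (e : W ≃ ((i : Fin (Fintype.card B)) → Fin (d i)))
    (he : ∀ w, ∑ i, (e w i : ℕ) = cs.length w) {q : ℝ} (hq : 0 < q) (i : Fin (Fintype.card B)) :
    Var[fun w => ((e w i : ℕ) : ℝ); cs.mallows q] =
      Var[fun k : Fin (d i) => ((k : ℕ) : ℝ); truncatedGeometric (d i) q] := by
  rw [← map_mallows_coordinate hd e he hq i, variance_map (measurable_of_finite _).aemeasurable
    (measurable_of_finite _).aemeasurable]
  rfl

end CoxeterSystem

end

theorem mainTheorem11 {B W : Type*} [Fintype B] [DecidableEq B] [Group W] [Fintype W]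
    [MeasurableSpace W] [MeasurableSingletonClass W]
    {M : CoxeterMatrix B} (cs : CoxeterSystem M W)
    (d : Fin (Fintype.card B) → ℕ) (hd : cs.IsDegrees d) (q : ℝ) (hq : 0 < q) :
    IsProbabilityMeasure (cs.mallows q) ∧
    (∃ Z : Fin (Fintype.card B) → W → ℕ,
      iIndepFun Z (cs.mallows q) ∧
      (∀ w, cs.length w = ∑ i, Z i w) ∧
      (∀ i (t : ℝ), mgf (fun w => (Z i w : ℝ)) (cs.mallows q) t =
        (∑ k ∈ Finset.range (d i), (Real.exp t * q) ^ k) / ∑ k ∈ Finset.range (d i), q ^ k)) ∧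
    (q ≠ 1 →
      ∫ w, (cs.length w : ℝ) ∂(cs.mallows q) =
        (Fintype.card B : ℝ) * q / (1 - q) - ∑ i, (d i : ℝ) * q ^ d i / (1 - q ^ d i) ∧
      Var[fun w => (cs.length w : ℝ); cs.mallows q] =
        (Fintype.card B : ℝ) * q / (1 - q) ^ 2 -
          ∑ i, (d i : ℝ) ^ 2 * q ^ d i / (1 - q ^ d i) ^ 2) := by
  have hpos := hd.pos
  have hprob := cs.isProbabilityMeasure_mallows hq
  obtain ⟨e, he⟩ := hd.exists_equiv
  have hind : iIndepFun (fun i w => ((e w i : Fin (d i)) : ℕ)) (cs.mallows q) :=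
    (CoxeterSystem.iIndepFun_coordinates hpos e he hq).comp (fun _ k => (k : ℕ))
      fun _ => measurable_of_finite _
  have hlen : ∀ w, (cs.length w : ℝ) = ∑ i, ((e w i : ℕ) : ℝ) := fun w => by
    rw [← he]
    push_cast
    rfl
  refine ⟨hprob, ⟨fun i w => e w i, hind, fun w => (he w).symm, fun i t => ?_⟩, fun hq1 => ⟨?_, ?_⟩⟩
  · rw [mgf, CoxeterSystem.integral_coordinate hpos e he hq i fun k => Real.exp (t * k),
      integral_truncatedGeometric (hpos i) hq fun k => Real.exp (t * k)]
    congr 1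
    refine Finset.sum_congr rfl fun k _ => ?_
    rw [mul_pow, ← Real.exp_nat_mul, mul_comm t, mul_comm]
  · simp only [hlen]
    rw [integral_finsetSum _ fun i _ => Integrable.of_finite]
    have hi := fun i => (CoxeterSystem.integral_coordinate hpos e he hq i fun k => (k : ℝ)).trans
      (integral_id_truncatedGeometric (hpos i) hq hq1)
    rw [Finset.sum_congr rfl fun i _ => hi i, Finset.sum_sub_distrib, Finset.sum_const,
      Finset.card_univ, Fintype.card_fin, nsmul_eq_mul, mul_div_assoc]
  · have hsum : (fun w => (cs.length w : ℝ)) = ∑ i, fun w => ((e w i : ℕ) : ℝ) := by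
      ext w
      rw [hlen, Finset.sum_apply]
    -- Pairwise independence suffices for variances to add.
    rw [hsum, IndepFun.variance_sum (X := fun i w => ((e w i : ℕ) : ℝ))
      (fun i _ => MemLp.of_discrete) fun i _ j _ hij =>
        (hind.indepFun hij).comp (measurable_of_countable fun k : ℕ => (k : ℝ))
          (measurable_of_countable fun k : ℕ => (k : ℝ))]
    have hi := fun i => (CoxeterSystem.variance_coordinate hpos e he hq i).trans
      (variance_truncatedGeometric (hpos i) hq hq1)
    rw [Finset.sum_congr rfl fun i _ => hi i, Finset.sum_sub_distrib, Finset.sum_const,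
      Finset.card_univ, Fintype.card_fin, nsmul_eq_mul, mul_div_assoc]
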